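/- All systems are finite-dimensional, all logarithms are to base $2$, $\|M\|_1=\operatorname{Tr}\sqrt{M^\dagger M}$ is the trace norm, and entropic quantities take values in $[-\infty,\infty]$. For positive semidefinite $\rho,\sigma$ put $$D_{\max}(\rho\|\sigma)=\inf\{\lambda\in\mathbb R:\rho\le 2^{\lambda}\sigma\},\qquad 2^{-D_H^{\delta}(\rho\|\sigma)}=\min\{\operatorname{Tr}(\Pi\sigma):0\le\Pi\le \mathbb I,\ \operatorname{Tr}(\Pi\rho)\ge 1-\delta\}.$$ For a bipartite positive semidefinite operator $\rho^{XY}$ put $I_{\max}(X:Y)_\rho=D_{\max}(\rho^{XY}\|\rho^X\otimes\rho^Y)$, and for a bipartite state $\rho^{XY}$ and $\delta>0$ put $$I_H^{\delta}(X:Y)_\rho=D_H^{\delta}(\rho^{XY}\|\rho^X\otimes\rho^Y),\qquad I_{\max}^{\delta}(X:Y)_\rho=\inf\{I_{\max}(X:Y)_\tau:\ \tau^{XY}\ge0,\ \operatorname{Tr}\tau\le1,\ \|\tau-\rho\|_1\le\delta\}.$$ **Theorem.** There are universal constants $0<c\le 1$ and $K>0$ such that for every tripartite quantum state $\rho^{ABC}$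 (of arbitrary finite dimensions) and every $\varepsilon>0$, with $\varepsilon'=\varepsilon''=\varepsilon'''=c\,\varepsilon^2$, $$I_{\max}^{\varepsilon}(AB:C)_\rho\ \le\ I_{\max}^{\varepsilon'}(A:C)_\rho+I_{\max}^{\varepsilon''}(B:AC)_\rho-I_H^{\varepsilon'''}(A:B)_\rho+K\,(1+|\log\varepsilon|).$$ (For $0<\varepsilon<1$ all terms are finite; for $\varepsilon\ge1$ the left-hand side is $-\infty$, since $\tau=0$ is admissible in the infimum, and the inequality is trivial.) -/

import Mathlib

open scoped Kronecker ComplexOrder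

noncomputable section

namespace OneShot

/-- A quantum state on the system with (finite) index set `X`: a positive semidefinite complex
matrix of trace one. -/
def IsState {X : Type*} [Fintype X] (ρ : Matrix X X ℂ) : Prop :=
  ρ.PosSemidef ∧ ρ.trace = 1

/-- The marginal on the first system, `X`: the partial trace over `Y`. -/
def marginalLeft {X Y : Type*} [Fintype Y] (ρ : Matrix (X × Y) (X × Y) ℂ) : Matrix X X ℂ :=
  Matrix.of fun x x' => ∑ y, ρ (x, y) (x', y)

/-- The marginal on the second system, `Y`: the partial trace over `X`. -/
def marginalRight {X Y : Type*} [Fintype X] (ρ : Matrix (X × Y) (X × Y) ℂ) : Matrix Y Y ℂ :=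
  Matrix.of fun y y' => ∑ x, ρ (x, y) (x, y')

/-- The trace norm `‖M‖₁`: the sum of the singular values of `M`. -/
def traceNorm {X : Type*} [Fintype X] [DecidableEq X] (M : Matrix X X ℂ) : ℝ :=
  ∑ i, Real.sqrt ((Matrix.isHermitian_conjTranspose_mul_self M).eigenvalues i)

/-- The `ε`-ball around `ρ`: all `τ ≥ 0` with `‖τ - ρ‖₁ ≤ ε` and `Tr τ ≤ 1`. -/
def ball {X : Type*} [Fintype X] [DecidableEq X] (ε : ℝ) (ρ : Matrix X X ℂ) :
    Set (Matrix X X ℂ) :=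
  {τ | τ.PosSemidef ∧ traceNorm (τ - ρ) ≤ ε ∧ τ.trace.re ≤ 1}

/-- The max relative entropy: the infimum of all real `l` with `ρ ≤ 2 ^ l σ`
(it is `⊤` if there is no such `l`, and `⊥` if every real `l` is admissible, as for `ρ = 0`). -/
def Dmax {X : Type*} [Fintype X] (ρ σ : Matrix X X ℂ) : EReal :=
  ⨅ (l : ℝ) (_ : ((((2 : ℝ) ^ l : ℝ) : ℂ) • σ - ρ).PosSemidef), (l : EReal)

/-- The max mutual information `I_max(X:Y)` of `ρ`. -/
def Imax {X Y : Type*} [Fintype X] [Fintype Y] (ρ : Matrix (X × Y) (X × Y) ℂ) : EReal :=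
  Dmax ρ (marginalLeft ρ ⊗ₖ marginalRight ρ)

/-- The smooth max mutual information `I_max^ε(X:Y)` of `ρ`. The infimum is over all `τ` in the
`ε`-ball, and both marginals are those of `τ`. -/
def smoothImax {X Y : Type*} [Fintype X] [Fintype Y] [DecidableEq X] [DecidableEq Y]
    (ε : ℝ) (ρ : Matrix (X × Y) (X × Y) ℂ) : EReal :=
  ⨅ τ ∈ ball ε ρ, Imax τ

/-- The minimum of `Tr (T σ)` over all tests `0 ≤ T ≤ 1` with `Tr (T ρ) ≥ 1 - ε`. -/
def minError {X : Type*} [Fintype X] [DecidableEq X] (ε : ℝ) (ρ σ : Matrix X X ℂ) : ℝ :=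
  sInf {t : ℝ | ∃ T : Matrix X X ℂ, T.PosSemidef ∧ (1 - T).PosSemidef ∧
    1 - ε ≤ (T * ρ).trace.re ∧ t = (T * σ).trace.re}

open Classical in
/-- The smooth hypothesis testing relative entropy, `-log₂` of `minError ε ρ σ`
(with `-log₂ 0 = ⊤`). -/
def DH {X : Type*} [Fintype X] [DecidableEq X] (ε : ℝ) (ρ σ : Matrix X X ℂ) : EReal :=
  if minError ε ρ σ = 0 then ⊤ else ((-Real.logb 2 (minError ε ρ σ) : ℝ) : EReal)

/-- The smooth hypothesis testing mutual information `I_H^ε(X:Y)` of `ρ`. -/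
def IH {X Y : Type*} [Fintype X] [Fintype Y] [DecidableEq X] [DecidableEq Y]
    (ε : ℝ) (ρ : Matrix (X × Y) (X × Y) ℂ) : EReal :=
  DH ε ρ (marginalLeft ρ ⊗ₖ marginalRight ρ)

/-- A tripartite state written with the systems grouped as `AB : C`, regrouped as `B : AC`. -/
def regroup {A B C : Type*} (ρ : Matrix ((A × B) × C) ((A × B) × C) ℂ) :
    Matrix (B × (A × C)) (B × (A × C)) ℂ :=
  ρ.submatrix (fun s => ((s.2.1, s.1), s.2.2)) (fun s => ((s.2.1, s.1), s.2.2))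

/-- The marginal `ρ^{AB}` of a tripartite state. -/
def marginalAB {A B C : Type*} [Fintype C] (ρ : Matrix ((A × B) × C) ((A × B) × C) ℂ) :
    Matrix (A × B) (A × B) ℂ :=
  marginalLeft ρ

/-- The marginal `ρ^{AC}` of a tripartite state. -/
def marginalAC {A B C : Type*} [Fintype B] (ρ : Matrix ((A × B) × C) ((A × B) × C) ℂ) :
    Matrix (A × C) (A × C) ℂ :=
  marginalRight (regroup ρ)

end OneShot

end

/-! Take near-optimal operators `τ` for `A : C` and `ω` for `B : AC`, and a test `T` for `A : B`,
all with error `q ^ 2`. The bound `ω ≤ 2^b ω^{AC} ⊗ ω^B` would give the claim by substitution if the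
marginals fitted together: replace `ω^{AC}` by `τ ≤ 2^a τ^A ⊗ τ^C`, then `τ^A ⊗ ω^B` by `ρ^A ⊗ ρ^B`,
then that by a multiple of `ρ^{AB}`. They fit only approximately, and closeness in trace norm gives
no operator inequality.

The remedy is to conjugate `ω` by operators acting on one subsystem at a time. If `E ≤ ρ + D` with
`Tr D` small, then `G = ρ (ρ + Δ)⁻¹`, with `Δ` slightly larger than `D`, brings `E` below `ρ` and
hardly moves it (`exists_le_of_le_add`). The last replacement uses a Neyman–Pearson projection `P`,
which turns the trace bounds of the test into the operator inequality `(δ / m) P (ρ^A ⊗ ρ^B) P ≤ P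
ρ^{AB} P`. Conjugation by a local operator maps a product to a product, so the four operators
compose (`exists_sandwich_le`), and gentle measurement (`close_sandwich`) keeps the result within
`O(q)` of `ρ`.

This yields a bound by some product `σ ⊗ τ^C`, while `I_max` demands the marginals of the operator
itself. `exists_close_le_marginals` repairs this at the cost of a factor `9 / q ^ 4`. With the
factor `1 / q ^ 2` from `P`, the total loss is `log (9 / q ^ 6)`, which is `O(1 + |log ε|)` for `q =
ε / 1000`. -/

noncomputable section
namespace OneShot
open scoped MatrixOrder
open Matrix

/-! ### Loewner order, real trace and conjugation -/

section Basic

variable {X : Type*}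

lemma smul_mono {c : ℝ} (hc : 0 ≤ c) {M N : Matrix X X ℂ} (h : M ≤ N) : c • M ≤ c • N := by
  have := (le_iff.1 h).smul hc
  rw [smul_sub] at this
  exact le_iff.2 this

lemma smul_mono_left {c d : ℝ} (hcd : c ≤ d) {M : Matrix X X ℂ} (h : 0 ≤ M) : c • M ≤ d • M := by
  have := (nonneg_iff_posSemidef.1 h).smul (sub_nonneg.2 hcd)
  rw [sub_smul] at this
  exact le_iff.2 this

lemma smul_nonneg' {c : ℝ} (hc : 0 ≤ c) {M : Matrix X X ℂ} (h : 0 ≤ M) : 0 ≤ c • M := by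
  simpa using smul_mono hc h

lemma isHermitian_of_nonneg {M : Matrix X X ℂ} (h : 0 ≤ M) : Mᴴ = M :=
  (nonneg_iff_posSemidef.1 h).isHermitian

variable [Fintype X]

/-- The real part of the trace. -/
def retr {X : Type*} [Fintype X] (M : Matrix X X ℂ) : ℝ := M.trace.re

/-- The conjugation `V ω V†`. -/
def sandwich {X : Type*} [Fintype X] (V ω : Matrix X X ℂ) : Matrix X X ℂ := V * ω * Vᴴ

@[simp] lemma retr_add (M N : Matrix X X ℂ) : retr (M + N) = retr M + retr N := by simp [retr]
@[simp] lemma retr_sub (M N : Matrix X X ℂ) : retr (M - N) = retr M - retr N := by simp [retr]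
@[simp] lemma retr_neg (M : Matrix X X ℂ) : retr (-M) = -retr M := by simp [retr]
@[simp] lemma retr_zero : retr (0 : Matrix X X ℂ) = 0 := by simp [retr]
@[simp] lemma retr_smul (c : ℝ) (M : Matrix X X ℂ) : retr (c • M) = c * retr M := by simp [retr]

lemma retr_mul_comm (M N : Matrix X X ℂ) : retr (M * N) = retr (N * M) := by
  simp [retr, Matrix.trace_mul_comm M N]

lemma retr_nonneg {M : Matrix X X ℂ} (h : 0 ≤ M) : 0 ≤ retr M :=
  (Complex.le_def.1 (nonneg_iff_posSemidef.1 h).trace_nonneg).1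

lemma retr_mono {M N : Matrix X X ℂ} (h : M ≤ N) : retr M ≤ retr N := by
  have := retr_nonneg (sub_nonneg.2 h); simp at this; exact this

lemma sandwich_nonneg (V : Matrix X X ℂ) {ω : Matrix X X ℂ} (h : 0 ≤ ω) : 0 ≤ sandwich V ω :=
  nonneg_iff_posSemidef.2 ((nonneg_iff_posSemidef.1 h).mul_mul_conjTranspose_same V)

@[simp] lemma sandwich_sub (V ω ω' : Matrix X X ℂ) :
    sandwich V (ω - ω') = sandwich V ω - sandwich V ω' := by
  simp [sandwich, mul_sub, sub_mul]

@[simp] lemma sandwich_smul (V ω : Matrix X X ℂ) (c : ℝ) :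
    sandwich V (c • ω) = c • sandwich V ω := by
  simp [sandwich]

lemma sandwich_sandwich (V W ω : Matrix X X ℂ) :
    sandwich V (sandwich W ω) = sandwich (V * W) ω := by
  simp [sandwich, mul_assoc]

lemma sandwich_mono (V : Matrix X X ℂ) {ω ω' : Matrix X X ℂ} (h : ω ≤ ω') :
    sandwich V ω ≤ sandwich V ω' := by
  have := sandwich_nonneg V (sub_nonneg.2 h)
  rwa [sandwich_sub, sub_nonneg] at this

lemma retr_sandwich_of_proj {P : Matrix X X ℂ} (hP : Pᴴ = P) (hPP : P * P = P)
    (ω : Matrix X X ℂ) : retr (sandwich P ω) = retr (P * ω) := by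
  rw [sandwich, hP, retr_mul_comm, ← mul_assoc, hPP]

variable [DecidableEq X] in
lemma retr_mul_nonneg {M N : Matrix X X ℂ} (hM : 0 ≤ M) (hN : 0 ≤ N) : 0 ≤ retr (M * N) := by
  obtain ⟨S, rfl⟩ := CStarAlgebra.nonneg_iff_eq_star_mul_self.1 hM
  have := retr_nonneg (sandwich_nonneg S hN)
  rwa [sandwich, retr_mul_comm, ← mul_assoc] at this

variable [DecidableEq X] in
lemma retr_mul_mono {M N N' : Matrix X X ℂ} (hM : 0 ≤ M) (hN : N ≤ N') :
    retr (M * N) ≤ retr (M * N') := by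
  have := retr_mul_nonneg hM (sub_nonneg.2 hN)
  rwa [mul_sub, retr_sub, sub_nonneg] at this

/-- Parallelogram identity: the difference of the two sides is the conjugation by `V - W`. -/
lemma sandwich_le_double (V W : Matrix X X ℂ) {ω : Matrix X X ℂ} (h : 0 ≤ ω) :
    sandwich (V + W) ω ≤ (2 : ℝ) • (sandwich V ω + sandwich W ω) := by
  have := sandwich_nonneg (V - W) h
  have e : (2 : ℝ) • (sandwich V ω + sandwich W ω) - sandwich (V + W) ω = sandwich (V - W) ω := by
    simp only [sandwich, conjTranspose_add, conjTranspose_sub, two_smul]; noncomm_ring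
  rwa [← e, sub_nonneg] at this

lemma retr_sandwich_add_le (V W : Matrix X X ℂ) {ω : Matrix X X ℂ} (h : 0 ≤ ω) :
    retr (sandwich (V + W) ω) ≤ 2 * (retr (sandwich V ω) + retr (sandwich W ω)) := by
  simpa [mul_add] using retr_mono (sandwich_le_double V W h)

lemma sandwich_neg (V : Matrix X X ℂ) (ω : Matrix X X ℂ) : sandwich (-V) ω = sandwich V ω := by
  simp [sandwich]

end Basic

/-! ### Trace norm and spectral projections of Hermitian matrices -/

section Spectral

variable {X : Type*} [Fintype X] [DecidableEq X]

lemma traceNorm_eq_sum_abs {H : Matrix X X ℂ} (hH : H.IsHermitian) :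
    traceNorm H = ∑ i, |hH.eigenvalues i| := by
  have h1 : Hᴴ * H = cfc (fun x : ℝ => x ^ 2) H := by
    rw [cfc_pow_id (R := ℝ) H 2 hH.isSelfAdjoint, hH.eq, pow_two]
  have h2 := hH.charpoly_cfc_eq (fun x : ℝ => x ^ 2)
  rw [← h1, (isHermitian_conjTranspose_mul_self H).charpoly_eq] at h2
  have roots_eq (f : X → ℂ) : (∏ i, (Polynomial.X - Polynomial.C (f i))).roots =
      Multiset.map f Finset.univ.val := by
    rw [Polynomial.roots_prod]
    · simp
    · simp [Finset.prod_ne_zero_iff, Polynomial.X_sub_C_ne_zero]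
  -- The eigenvalues of `Hᴴ * H` and the squares of those of `H` may be indexed in different orders,
  -- so only a symmetric function of the roots can be compared.
  have h3 := congrArg (fun p => (p.roots.map fun z : ℂ => Real.sqrt z.re).sum) h2
  simp only [roots_eq, Multiset.map_map] at h3
  calc traceNorm H = _ := rfl
    _ = _ := h3
    _ = _ := Finset.sum_congr rfl fun i _ => by
      simp only [Function.comp_apply]
      rw [show ((RCLike.ofReal (hH.eigenvalues i ^ 2) : ℂ)).re = hH.eigenvalues i ^ 2 from
        RCLike.ofReal_re (K := ℂ) _, Real.sqrt_sq_eq_abs]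

/-- `P` is the indicator of the nonnegative eigenvalues; every claim is then checked on diagonal
matrices in an eigenbasis. -/
lemma exists_spectral_projection {H : Matrix X X ℂ} (hH : H.IsHermitian) :
    ∃ P : Matrix X X ℂ, Pᴴ = P ∧ P * P = P ∧ P * H = H * P ∧ 0 ≤ P * H ∧ (1 - P) * H ≤ 0 ∧
      traceNorm H = retr (P * H) - retr ((1 - P) * H) := by
  set U : Matrix X X ℂ := (hH.eigenvectorUnitary : Matrix X X ℂ) with hU
  have hUU : U * Uᴴ = 1 := by
    exact Unitary.coe_mul_star_self hH.eigenvectorUnitary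
  have hUU' : Uᴴ * U = 1 := by
    exact Unitary.coe_star_mul_self hH.eigenvectorUnitary
  set ev := hH.eigenvalues with hev
  have hs : H = sandwich U (diagonal fun i => (ev i : ℂ)) := by
    conv_lhs => rw [hH.spectral_theorem, Unitary.conjStarAlgAut_apply]
    rfl
  have hmul : ∀ a b : X → ℂ, sandwich U (diagonal a) * sandwich U (diagonal b) =
      sandwich U (diagonal fun i => a i * b i) := by
    intro a b
    rw [← diagonal_mul_diagonal]
    simp only [sandwich]
    calc _ = U * diagonal a * (Uᴴ * U) * diagonal b * Uᴴ := by simp only [mul_assoc]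
      _ = _ := by rw [hUU']; simp only [mul_assoc, one_mul]
  have htr : ∀ a : X → ℂ, retr (sandwich U (diagonal a)) = ∑ i, (a i).re := by
    intro a
    rw [sandwich, retr_mul_comm, ← mul_assoc, hUU', one_mul, retr, trace_diagonal, Complex.re_sum]
  have hone : (1 : Matrix X X ℂ) = sandwich U (diagonal fun _ => 1) := by
    simp [sandwich, hUU]
  have hsub : ∀ a b : X → ℂ, sandwich U (diagonal a) - sandwich U (diagonal b) =
      sandwich U (diagonal fun i => a i - b i) := by
    intro a b
    rw [← sandwich_sub, diagonal_sub]
  have hpos : ∀ a : X → ℂ, (∀ i, 0 ≤ a i) → 0 ≤ sandwich U (diagonal a) := fun a ha =>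
    sandwich_nonneg _ (nonneg_iff_posSemidef.2 (PosSemidef.diagonal ha))
  refine ⟨sandwich U (diagonal fun i => if 0 ≤ ev i then 1 else 0), ?_, ?_, ?_, ?_, ?_, ?_⟩
  · refine isHermitian_of_nonneg (hpos _ fun i => ?_)
    split_ifs <;> simp
  · rw [hmul]; congr 2; ext i; split_ifs <;> simp
  · conv_lhs => rw [hs]
    conv_rhs => rw [hs]
    rw [hmul, hmul]; congr 2; ext i; ring
  · conv_rhs => rw [hs]
    rw [hmul]
    refine hpos _ fun i => ?_
    split_ifs with h <;> simp [h]
  · conv_lhs => rw [hs]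
    rw [hone, hsub, hmul, ← sub_nonneg,
      show (0 : Matrix X X ℂ) = sandwich U (diagonal fun _ => 0) by simp [sandwich], hsub]
    refine le_of_eq_of_le (by simp [sandwich]) (hpos _ fun i => ?_)
    split_ifs with h
    · simp
    · simp only [zero_sub, sub_zero, one_mul, neg_nonneg]
      exact_mod_cast (not_le.1 h).le
  · rw [traceNorm_eq_sum_abs hH]
    conv_rhs => rw [hs]
    simp only [← hev]
    rw [hone, hsub, hmul, hmul, htr, htr, ← Finset.sum_sub_distrib]
    refine Finset.sum_congr rfl fun i _ => ?_
    split_ifs with h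
    · simp [abs_of_nonneg h]
    · simp [abs_of_neg (not_le.1 h)]

end Spectral

/-! ### Closeness, gentle measurement, and operators that restore an order relation -/

section Close

variable {X : Type*}

lemma compl_conjTranspose [DecidableEq X] {P : Matrix X X ℂ} (hP : Pᴴ = P) : (1 - P)ᴴ = 1 - P := by
  rw [conjTranspose_sub, hP, conjTranspose_one]

variable [Fintype X]

/-- `M` and `N` differ by at most `d`: some `D` with trace at most `d` dominates `±(M - N)`. For
Hermitian matrices this says that `‖M - N‖₁ ≤ d`. -/
def Close (d : ℝ) (M N : Matrix X X ℂ) : Prop :=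
  ∃ D : Matrix X X ℂ, M - N ≤ D ∧ N - M ≤ D ∧ retr D ≤ d

lemma Close.symm {d : ℝ} {M N : Matrix X X ℂ} (h : Close d M N) : Close d N M := by
  obtain ⟨D, h1, h2, h3⟩ := h
  exact ⟨D, h2, h1, h3⟩

lemma Close.trans {d d' : ℝ} {M N K : Matrix X X ℂ} (h : Close d M N) (h' : Close d' N K) :
    Close (d + d') M K := by
  obtain ⟨D, h1, h2, h3⟩ := h
  obtain ⟨D', h1', h2', h3'⟩ := h'
  refine ⟨D + D', ?_, ?_, by simpa using add_le_add h3 h3'⟩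
  · simpa using add_le_add h1 h1'
  · simpa [add_comm] using add_le_add h2' h2

lemma Close.mono {d d' : ℝ} (hd : d ≤ d') {M N : Matrix X X ℂ} (h : Close d M N) :
    Close d' M N := by
  obtain ⟨D, h1, h2, h3⟩ := h
  exact ⟨D, h1, h2, h3.trans hd⟩

lemma close_of_le {M N : Matrix X X ℂ} (h : N ≤ M) : Close (retr M - retr N) M N := by
  refine ⟨M - N, le_rfl, ?_, by simp⟩
  have := sub_nonneg.2 h
  refine le_trans ?_ this
  rw [← neg_sub, neg_nonpos]; exact this

lemma Close.exists_le_add {d : ℝ} {M N : Matrix X X ℂ} (h : Close d M N) :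
    ∃ D : Matrix X X ℂ, 0 ≤ D ∧ M ≤ N + D ∧ N ≤ M + D ∧ retr D ≤ d := by
  obtain ⟨D, h1, h2, h3⟩ := h
  refine ⟨D, ?_, by rwa [← sub_le_iff_le_add'], by rwa [← sub_le_iff_le_add'], h3⟩
  have := add_le_add h1 h2
  have h4 : 0 ≤ (2⁻¹ : ℝ) • (D + D) := smul_nonneg' (by norm_num) (by simpa using this)
  rwa [← two_smul ℝ D, smul_smul, inv_mul_cancel₀ two_ne_zero, one_smul] at h4

lemma retr_submatrix {Y : Type*} [Fintype Y] (e : Y ≃ X) (M : Matrix X X ℂ) :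
    retr (M.submatrix e e) = retr M := by
  simp only [retr, trace, diag_apply, submatrix_apply]
  rw [Equiv.sum_comp e fun i => M i i]

lemma Close.submatrix {Y : Type*} [Fintype Y] (e : Y ≃ X) {d : ℝ} {M N : Matrix X X ℂ}
    (h : Close d M N) : Close d (M.submatrix e e) (N.submatrix e e) := by
  obtain ⟨D, h1, h2, h3⟩ := h
  refine ⟨D.submatrix e e, le_iff.2 ((le_iff.1 h1).submatrix e),
    le_iff.2 ((le_iff.1 h2).submatrix e), ?_⟩
  rwa [retr_submatrix]

lemma Close.retr_le {d : ℝ} {M N : Matrix X X ℂ} (h : Close d M N) : retr M ≤ retr N + d := by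
  obtain ⟨D, h1, h2, h3⟩ := h
  have := retr_mono h1
  simp only [retr_sub] at this
  linarith

lemma retr_proj_mul_mono {P : Matrix X X ℂ} (hP : Pᴴ = P) (hPP : P * P = P) {M N : Matrix X X ℂ}
    (h : M ≤ N) : retr (P * M) ≤ retr (P * N) := by
  rw [← retr_sandwich_of_proj hP hPP, ← retr_sandwich_of_proj hP hPP]
  exact retr_mono (sandwich_mono P h)

variable [DecidableEq X]

lemma compl_mul_self {P : Matrix X X ℂ} (hPP : P * P = P) : (1 - P) * (1 - P) = 1 - P := by
  simp [mul_sub, sub_mul, hPP]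

lemma close_of_traceNorm_le {d : ℝ} {M N : Matrix X X ℂ} (hM : M.IsHermitian)
    (hN : N.IsHermitian) (h : traceNorm (M - N) ≤ d) : Close d M N := by
  obtain ⟨P, -, -, -, h1, h2, h3⟩ := exists_spectral_projection (hM.sub hN)
  refine ⟨P * (M - N) - (1 - P) * (M - N), ?_, ?_, by rw [retr_sub, ← h3]; exact h⟩
  · rw [← sub_nonneg]
    have := add_nonneg (neg_nonneg.2 h2) (neg_nonneg.2 h2)
    convert this using 1
    noncomm_ring
  · rw [← sub_nonneg]
    have := add_nonneg h1 h1
    convert this using 1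
    noncomm_ring

lemma Close.traceNorm_le {d : ℝ} {M N : Matrix X X ℂ} (hM : M.IsHermitian)
    (hN : N.IsHermitian) (h : Close d M N) : traceNorm (M - N) ≤ d := by
  obtain ⟨D, h1, h2, h3⟩ := h
  obtain ⟨P, hP, hPP, -, -, -, h4⟩ := exists_spectral_projection (hM.sub hN)
  have e1 := retr_proj_mul_mono hP hPP h1
  have e2 := retr_proj_mul_mono (compl_conjTranspose hP) (compl_mul_self hPP) h2
  rw [← neg_sub M N, mul_neg, retr_neg] at e2
  have e3 : retr (P * D) + retr ((1 - P) * D) = retr D := by rw [sub_mul, retr_sub]; simp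
  linarith

/-- Gentle measurement: an operator that hardly moves the amplitude hardly moves the state. -/
lemma close_sandwich {V ω : Matrix X X ℂ} (hω : 0 ≤ ω) (h1 : retr ω ≤ 1) {q : ℝ} (hq : 0 < q)
    (h : retr (sandwich (1 - V) ω) ≤ q ^ 2) : Close (2 * q + q ^ 2) (sandwich V ω) ω := by
  obtain ⟨W, rfl⟩ : ∃ W, V = 1 - W := ⟨1 - V, by simp⟩
  rw [sub_sub_cancel] at h
  have hn (s : ℝ) := sandwich_nonneg (1 - s • W) hω
  have hW := sandwich_nonneg W hω
  have expand (s : ℝ) : sandwich (1 - s • W) ω =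
      ω - s • (W * ω) - s • (ω * Wᴴ) + (s * s) • (sandwich W ω) := by
    simp only [sandwich, conjTranspose_sub, conjTranspose_one, conjTranspose_smul, sub_mul,
      mul_sub, one_mul, mul_one, smul_mul_assoc, mul_smul_comm, star_trivial]
    module
  have e1 : sandwich (1 - W) ω = ω - W * ω - ω * Wᴴ + sandwich W ω := by
    simpa using expand 1
  -- The cross terms `W ω + ω Wᴴ` are bounded on either side by `q ω + q⁻¹ W ω Wᴴ`, since
  -- conjugating `ω` by `1 ± q⁻¹ W` gives a nonnegative operator. The summand `W ω Wᴴ` absorbs the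
  -- quadratic term.
  refine ⟨q • ω + (1 + q⁻¹) • sandwich W ω, ?_, ?_, ?_⟩
  · rw [← sub_nonneg]
    have := smul_nonneg' hq.le (hn (-q⁻¹))
    convert this using 1
    rw [e1, expand]
    match_scalars <;> field_simp <;> ring
  · rw [← sub_nonneg]
    have := add_nonneg (smul_nonneg' hq.le (hn q⁻¹)) (add_nonneg hW hW)
    convert this using 1
    rw [e1, expand]
    match_scalars <;> field_simp <;> ring
  · simp only [retr_add, retr_smul]
    have e2 : (1 + q⁻¹) * retr (sandwich W ω) ≤ (1 + q⁻¹) * q ^ 2 := by gcongr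
    have e3 : (1 + q⁻¹) * q ^ 2 = q ^ 2 + q := by field_simp
    nlinarith

/-- Neyman–Pearson: a projection that is optimal for distinguishing `ρ` from `μ σ`. -/
lemma exists_neyman_pearson {ρ σ : Matrix X X ℂ} (hρ : 0 ≤ ρ) (hσ : 0 ≤ σ) {μ : ℝ} (hμ : 0 ≤ μ) :
    ∃ P : Matrix X X ℂ, Pᴴ = P ∧ P * P = P ∧ μ • sandwich P σ ≤ sandwich P ρ ∧
      (∀ T, 0 ≤ T → T ≤ 1 → retr (T * ρ) - μ * retr (T * σ) ≤ retr (P * ρ)) ∧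
      retr ((1 - P) * ρ) ≤ μ * retr σ := by
  have hH : (ρ - μ • σ).IsHermitian :=
    (nonneg_iff_posSemidef.1 hρ).isHermitian.sub
      (nonneg_iff_posSemidef.1 (smul_nonneg' hμ hσ)).isHermitian
  -- `P` projects onto the nonnegative part of `ρ - μ σ`.
  obtain ⟨P, hP, hPP, hc, h1, h2, -⟩ := exists_spectral_projection hH
  set H := ρ - μ • σ with hHdef
  have hPσ : 0 ≤ retr (P * σ) := by simpa using retr_proj_mul_mono hP hPP hσ
  have hPσ' : 0 ≤ retr ((1 - P) * σ) := by
    simpa using retr_proj_mul_mono (compl_conjTranspose hP) (compl_mul_self hPP) hσ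
  have hT (T : Matrix X X ℂ) : retr (T * H) = retr (T * ρ) - μ * retr (T * σ) := by
    rw [hHdef, mul_sub, retr_sub, mul_smul_comm, retr_smul]
  refine ⟨P, hP, hPP, ?_, fun T hT0 hT1 => ?_, ?_⟩
  · rw [← sub_nonneg, ← sandwich_smul, ← sandwich_sub, ← hHdef, sandwich, hP, mul_assoc, ← hc,
      ← mul_assoc, hPP]
    exact h1
  · have e1 := retr_mul_nonneg (sub_nonneg.2 hT1) h1
    have e2 := retr_mul_mono hT0 h2
    have e3 : retr (T * H) = retr (T * (P * H)) + retr (T * ((1 - P) * H)) := by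
      rw [← retr_add, ← mul_add, ← add_mul]; simp
    rw [sub_mul, retr_sub, one_mul] at e1
    rw [mul_zero, retr_zero] at e2
    have := hT T
    have := hT P
    nlinarith
  · have e := retr_mono h2
    rw [hT, retr_zero] at e
    have e4 : retr (P * σ) + retr ((1 - P) * σ) = retr σ := by rw [sub_mul, retr_sub]; simp
    nlinarith

/-- This is the parallel sum of `ρ` and `Δ`. It is symmetric in the two, and inserting `(ρ + Δ) (ρ +
Δ)⁻¹` splits it into a conjugate of `Δ` and a conjugate of `ρ`. -/
lemma parallelSum_nonneg {ρ Δ : Matrix X X ℂ} (hρ : 0 ≤ ρ) (hΔ : 0 ≤ Δ)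
    (hM : (ρ + Δ).PosDef) : 0 ≤ ρ * (ρ + Δ)⁻¹ * Δ := by
  set M := ρ + Δ with hMdef
  have hMu : IsUnit M.det := (Matrix.isUnit_iff_isUnit_det M).1 hM.isUnit
  have hM1 : M * M⁻¹ = 1 := Matrix.mul_nonsing_inv M hMu
  have hM2 : M⁻¹ * M = 1 := Matrix.nonsing_inv_mul M hMu
  have hMi : (M⁻¹)ᴴ = M⁻¹ := hM.inv.isHermitian
  have hcomm : ρ * M⁻¹ * Δ = Δ * M⁻¹ * ρ := by
    have e1 : ρ = M - Δ := by simp [hMdef]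
    rw [e1]
    simp only [sub_mul, mul_sub, hM1, mul_assoc, hM2]
    simp
  have h1 := sandwich_nonneg (ρ * M⁻¹) hΔ
  have h2 := sandwich_nonneg (Δ * M⁻¹) hρ
  have e : ρ * M⁻¹ * Δ = sandwich (ρ * M⁻¹) Δ + sandwich (Δ * M⁻¹) ρ := by
    simp only [sandwich, conjTranspose_mul, hMi, isHermitian_of_nonneg hρ,
      isHermitian_of_nonneg hΔ]
    calc ρ * M⁻¹ * Δ = ρ * M⁻¹ * (M * M⁻¹) * Δ := by rw [hM1, mul_one]
      _ = ρ * M⁻¹ * (ρ * M⁻¹ * Δ) + ρ * M⁻¹ * Δ * M⁻¹ * Δ := by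
        nth_rewrite 2 [hMdef]; noncomm_ring
      _ = ρ * M⁻¹ * (Δ * M⁻¹ * ρ) + Δ * M⁻¹ * ρ * M⁻¹ * Δ := by rw [hcomm]
      _ = _ := by simp only [mul_assoc]
  rw [e]
  exact add_nonneg h1 h2

/-- An operator on `X` that brings everything dominated by `ρ + D` below `ρ`, and hardly moves
its amplitude if `D` has small trace. -/
lemma exists_le_of_le_add {ρ D : Matrix X X ℂ} (hρ : 0 ≤ ρ) (hD : 0 ≤ D) {d : ℝ}
    (hd : retr D < d) : ∃ G : Matrix X X ℂ, ∀ E, E ≤ ρ + D →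
      sandwich G E ≤ ρ ∧ retr (sandwich (1 - G) E) ≤ d := by
  -- The slack in `retr D < d` pays for a multiple of the identity that makes `ρ + Δ` invertible.
  set η : ℝ := (d - retr D) / (Fintype.card X + 1) with hη
  have hη0 : 0 < η := div_pos (by linarith) (by positivity)
  have hone : (0 : Matrix X X ℂ) ≤ η • 1 := smul_nonneg' hη0.le (nonneg_iff_posSemidef.2 .one)
  have hηd : retr (η • (1 : Matrix X X ℂ)) ≤ d - retr D := by
    rw [retr_smul, retr, trace_one, hη, Complex.natCast_re, div_mul_eq_mul_div,
      div_le_iff₀ (by positivity)]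
    nlinarith
  set Δ := D + η • (1 : Matrix X X ℂ) with hΔdef
  have hΔ : 0 ≤ Δ := add_nonneg hD hone
  have hM : (ρ + Δ).PosDef := by
    rw [hΔdef, ← add_assoc]
    exact (PosDef.one.smul hη0).posSemidef_add (nonneg_iff_posSemidef.1 (add_nonneg hρ hD))
  have hpar := parallelSum_nonneg hρ hΔ hM
  set M := ρ + Δ with hMdef
  have hMu : IsUnit M.det := (Matrix.isUnit_iff_isUnit_det M).1 hM.isUnit
  have hM1 : M * M⁻¹ = 1 := Matrix.mul_nonsing_inv M hMu
  have hM2 : M⁻¹ * M = 1 := Matrix.nonsing_inv_mul M hMu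
  have hMi : (M⁻¹)ᴴ = M⁻¹ := hM.inv.isHermitian
  have hs (N : Matrix X X ℂ) (hN : 0 ≤ N) : sandwich (N * M⁻¹) M = N * M⁻¹ * N := by
    simp only [sandwich, conjTranspose_mul, hMi, isHermitian_of_nonneg hN]
    rw [mul_assoc N, hM2, mul_one, mul_assoc]
  have hG : 1 - ρ * M⁻¹ = Δ * M⁻¹ := by
    rw [← hM1, ← sub_mul]; simp [hMdef]
  have hEM (E : Matrix X X ℂ) (hE : E ≤ ρ + D) : E ≤ M := by
    rw [hMdef, hΔdef, ← add_assoc]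
    exact hE.trans (le_add_of_nonneg_right hone)
  -- With `G = ρ M⁻¹` and `1 - G = Δ M⁻¹`, conjugating `M` gives `ρ M⁻¹ ρ` and `Δ M⁻¹ Δ`. These are
  -- `ρ` and `Δ` minus the same parallel sum.
  refine ⟨ρ * M⁻¹, fun E hE => ⟨(sandwich_mono _ (hEM E hE)).trans ?_,
    (retr_mono (sandwich_mono _ (hEM E hE))).trans ?_⟩⟩
  · rw [hs ρ hρ, ← sub_nonneg]
    convert hpar using 1
    rw [show ρ * M⁻¹ * Δ = ρ * M⁻¹ * (M - ρ) by simp [hMdef], mul_sub, mul_assoc ρ M⁻¹ M, hM2,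
      mul_one]
  · rw [hG, hs Δ hΔ]
    have e : Δ * M⁻¹ * Δ = Δ - ρ * M⁻¹ * Δ := by
      rw [← hG, sub_mul, one_mul]
    rw [e, retr_sub]
    have := retr_nonneg hpar
    have h2 : retr Δ = retr D + retr (η • (1 : Matrix X X ℂ)) := by rw [hΔdef, retr_add]
    linarith

end Close

/-! ### Product operators, local operators and partial traces -/

section Local

variable {S X Y : Type*}

/-- The product operator `σ ⊗ θ` on a system `S` that is split as `X × Y`. -/
def prodOn {S X Y : Type*} (e : S ≃ X × Y) (σ : Matrix X X ℂ) (θ : Matrix Y Y ℂ) :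
    Matrix S S ℂ :=
  (σ ⊗ₖ θ).submatrix e e

/-- The operator `G ⊗ 1` on a system `S` that is split as `X × Y`. -/
def localOp {S X Y : Type*} [DecidableEq Y] (e : S ≃ X × Y) (G : Matrix X X ℂ) : Matrix S S ℂ :=
  prodOn e G 1

/-- The marginal on `X` for a system `S` that is split as `X × Y`. -/
def marginalOn {S X Y : Type*} [Fintype Y] (e : S ≃ X × Y) (ω : Matrix S S ℂ) : Matrix X X ℂ :=
  marginalLeft (ω.submatrix e.symm e.symm)

lemma prodOn_apply (e : S ≃ X × Y) (σ : Matrix X X ℂ) (θ : Matrix Y Y ℂ) (s t : S) :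
    prodOn e σ θ s t = σ (e s).1 (e t).1 * θ (e s).2 (e t).2 := rfl

lemma prodOn_conjTranspose (e : S ≃ X × Y) (σ : Matrix X X ℂ) (θ : Matrix Y Y ℂ) :
    (prodOn e σ θ)ᴴ = prodOn e σᴴ θᴴ := by
  rw [prodOn, prodOn, conjTranspose_submatrix, conjTranspose_kronecker]

lemma prodOn_smul_left (e : S ≃ X × Y) (c : ℝ) (σ : Matrix X X ℂ) (θ : Matrix Y Y ℂ) :
    prodOn e (c • σ) θ = c • prodOn e σ θ := by
  ext; simp [prodOn, mul_assoc]

lemma prodOn_smul_right (e : S ≃ X × Y) (c : ℝ) (σ : Matrix X X ℂ) (θ : Matrix Y Y ℂ) :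
    prodOn e σ (c • θ) = c • prodOn e σ θ := by
  ext; simp [prodOn, mul_left_comm]

lemma prodOn_sub_left (e : S ≃ X × Y) (σ σ' : Matrix X X ℂ) (θ : Matrix Y Y ℂ) :
    prodOn e (σ - σ') θ = prodOn e σ θ - prodOn e σ' θ := by
  ext; simp [prodOn, sub_mul]

lemma prodOn_sub_right (e : S ≃ X × Y) (σ : Matrix X X ℂ) (θ θ' : Matrix Y Y ℂ) :
    prodOn e σ (θ - θ') = prodOn e σ θ - prodOn e σ θ' := by
  ext; simp [prodOn, mul_sub]

lemma localOp_conjTranspose [DecidableEq Y] (e : S ≃ X × Y) (G : Matrix X X ℂ) :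
    (localOp e G)ᴴ = localOp e Gᴴ := by
  rw [localOp, localOp, prodOn_conjTranspose, conjTranspose_one]

lemma localOp_one_sub [DecidableEq Y] [DecidableEq S] [DecidableEq X] (e : S ≃ X × Y)
    (G : Matrix X X ℂ) : localOp e (1 - G) = 1 - localOp e G := by
  rw [localOp, localOp, prodOn_sub_left, prodOn, one_kronecker_one, submatrix_one_equiv]

variable [Fintype Y]

lemma marginalOn_apply (e : S ≃ X × Y) (ω : Matrix S S ℂ) (x x' : X) :
    marginalOn e ω x x' = ∑ y, ω (e.symm (x, y)) (e.symm (x', y)) := rfl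

lemma marginalOn_add (e : S ≃ X × Y) (ω ω' : Matrix S S ℂ) :
    marginalOn e (ω + ω') = marginalOn e ω + marginalOn e ω' := by
  ext; simp [marginalOn_apply, Finset.sum_add_distrib]

lemma marginalOn_sub (e : S ≃ X × Y) (ω ω' : Matrix S S ℂ) :
    marginalOn e (ω - ω') = marginalOn e ω - marginalOn e ω' := by
  ext; simp [marginalOn_apply, Finset.sum_sub_distrib]

lemma marginalOn_smul (e : S ≃ X × Y) (c : ℝ) (ω : Matrix S S ℂ) :
    marginalOn e (c • ω) = c • marginalOn e ω := by
  ext; simp [marginalOn_apply, Finset.mul_sum]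

lemma marginalOn_nonneg (e : S ≃ X × Y) {ω : Matrix S S ℂ} (h : 0 ≤ ω) :
    0 ≤ marginalOn e ω := by
  have : marginalOn e ω = ∑ y, ω.submatrix (fun x => e.symm (x, y)) (fun x => e.symm (x, y)) := by
    ext; simp [marginalOn_apply, Matrix.sum_apply]
  rw [this]
  exact Finset.sum_nonneg fun y _ =>
    nonneg_iff_posSemidef.2 ((nonneg_iff_posSemidef.1 h).submatrix _)

lemma marginalOn_prodOn (e : S ≃ X × Y) (σ : Matrix X X ℂ) {θ : Matrix Y Y ℂ} (hθ : 0 ≤ θ) :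
    marginalOn e (prodOn e σ θ) = retr θ • σ := by
  have h : θ.trace = (retr θ : ℂ) :=
    Complex.ext rfl (Complex.le_def.1 (nonneg_iff_posSemidef.1 hθ).trace_nonneg).2.symm
  ext x x'
  rw [Matrix.smul_apply, Complex.real_smul, ← h, mul_comm, trace, Finset.mul_sum]
  simp [marginalOn_apply, prodOn_apply]

lemma marginalOn_mono (e : S ≃ X × Y) {ω ω' : Matrix S S ℂ} (h : ω ≤ ω') :
    marginalOn e ω ≤ marginalOn e ω' := by
  rw [← sub_nonneg, ← marginalOn_sub]
  exact marginalOn_nonneg e (sub_nonneg.2 h)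

variable [Fintype X]

lemma prodOn_nonneg (e : S ≃ X × Y) {σ : Matrix X X ℂ} {θ : Matrix Y Y ℂ} (hσ : 0 ≤ σ)
    (hθ : 0 ≤ θ) : 0 ≤ prodOn e σ θ := by
  classical
  exact nonneg_iff_posSemidef.2
    (((nonneg_iff_posSemidef.1 hσ).kronecker (nonneg_iff_posSemidef.1 hθ)).submatrix e)

lemma prodOn_mono_left (e : S ≃ X × Y) {σ σ' : Matrix X X ℂ} {θ : Matrix Y Y ℂ} (h : σ ≤ σ')
    (hθ : 0 ≤ θ) : prodOn e σ θ ≤ prodOn e σ' θ := by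
  rw [← sub_nonneg, ← prodOn_sub_left]
  exact prodOn_nonneg e (sub_nonneg.2 h) hθ

lemma prodOn_mono_right (e : S ≃ X × Y) {σ : Matrix X X ℂ} {θ θ' : Matrix Y Y ℂ} (h : θ ≤ θ')
    (hσ : 0 ≤ σ) : prodOn e σ θ ≤ prodOn e σ θ' := by
  rw [← sub_nonneg, ← prodOn_sub_right]
  exact prodOn_nonneg e hσ (sub_nonneg.2 h)

variable [Fintype S]

lemma trace_marginalOn (e : S ≃ X × Y) (ω : Matrix S S ℂ) :
    (marginalOn e ω).trace = ω.trace := by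
  simp only [trace, diag_apply, marginalOn_apply]
  rw [← Equiv.sum_comp e.symm, Fintype.sum_prod_type]

lemma retr_marginalOn (e : S ≃ X × Y) (ω : Matrix S S ℂ) : retr (marginalOn e ω) = retr ω := by
  rw [retr, retr, trace_marginalOn]

lemma Close.marginalOn (e : S ≃ X × Y) {d : ℝ} {ω ω' : Matrix S S ℂ} (h : Close d ω ω') :
    Close d (marginalOn e ω) (marginalOn e ω') := by
  obtain ⟨D, h1, h2, h3⟩ := h
  refine ⟨OneShot.marginalOn e D, ?_, ?_, by rwa [retr_marginalOn]⟩
  · rw [← marginalOn_sub]; exact marginalOn_mono e h1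
  · rw [← marginalOn_sub]; exact marginalOn_mono e h2

lemma prodOn_mul (e : S ≃ X × Y) (σ σ' : Matrix X X ℂ) (θ θ' : Matrix Y Y ℂ) :
    prodOn e σ θ * prodOn e σ' θ' = prodOn e (σ * σ') (θ * θ') := by
  rw [prodOn, prodOn, prodOn, submatrix_mul_equiv, mul_kronecker_mul]

lemma retr_prodOn (e : S ≃ X × Y) (σ : Matrix X X ℂ) {θ : Matrix Y Y ℂ} (hθ : 0 ≤ θ) :
    retr (prodOn e σ θ) = retr θ * retr σ := by
  rw [← retr_marginalOn e, marginalOn_prodOn e σ hθ, retr_smul]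

lemma localOp_mul_apply [DecidableEq Y] (e : S ≃ X × Y) (G : Matrix X X ℂ) (ω : Matrix S S ℂ)
    (x : X) (y : Y) (t : S) : (localOp e G * ω) (e.symm (x, y)) t = ∑ x₁, G x x₁ * ω (e.symm (x₁, y)) t := by
  rw [mul_apply, ← Equiv.sum_comp e.symm, Fintype.sum_prod_type]
  simp [localOp, prodOn_apply, one_apply]

lemma mul_localOp_apply [DecidableEq Y] (e : S ≃ X × Y) (G : Matrix X X ℂ) (ω : Matrix S S ℂ)
    (x : X) (y : Y) (t : S) : (ω * localOp e G) t (e.symm (x, y)) = ∑ x₁, ω t (e.symm (x₁, y)) * G x₁ x := by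
  rw [mul_apply, ← Equiv.sum_comp e.symm, Fintype.sum_prod_type]
  simp [localOp, prodOn_apply, one_apply]

/-- The partial trace over `Y` is cyclic for operators on `Y`. -/
lemma marginalOn_localOp_mul_comm [DecidableEq X] (e : S ≃ X × Y) (R : Matrix Y Y ℂ)
    (ω : Matrix S S ℂ) :
    marginalOn e (localOp (e.trans (Equiv.prodComm X Y)) R * ω) =
      marginalOn e (ω * localOp (e.trans (Equiv.prodComm X Y)) R) := by
  ext x x'
  have h1 := localOp_mul_apply (e.trans (Equiv.prodComm X Y)) R ω
  have h2 := mul_localOp_apply (e.trans (Equiv.prodComm X Y)) R ω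
  simp only [Equiv.symm_trans_apply, Equiv.prodComm_symm, Equiv.prodComm_apply, Prod.swap_prod_mk]
    at h1 h2
  simp only [marginalOn_apply, h1, h2]
  rw [Finset.sum_comm]
  exact Finset.sum_congr rfl fun y _ => Finset.sum_congr rfl fun y' _ => mul_comm _ _

lemma localOp_mul [DecidableEq Y] (e : S ≃ X × Y) (G H : Matrix X X ℂ) :
    localOp e G * localOp e H = localOp e (G * H) := by
  rw [localOp, localOp, localOp, prodOn_mul, one_mul]

/-- A projective measurement on `Y` leaves the average state of `X` unchanged, by cyclicity of the
partial trace. -/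
lemma marginalOn_sandwich_add_compl [DecidableEq S] [DecidableEq X] (e : S ≃ X × Y)
    {R : Matrix Y Y ℂ} (hR : Rᴴ = R) (hRR : R * R = R) (ω : Matrix S S ℂ) :
    marginalOn e (sandwich (localOp (e.trans (Equiv.prodComm X Y)) R) ω) +
      marginalOn e (sandwich (1 - localOp (e.trans (Equiv.prodComm X Y)) R) ω) =
        marginalOn e ω := by
  set L := localOp (e.trans (Equiv.prodComm X Y)) R with hL
  have hLh : Lᴴ = L := by rw [hL, localOp_conjTranspose, hR]
  have hLL : L * L = L := by rw [hL, localOp_mul, hRR]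
  have h1 : marginalOn e (L * ω * L) = marginalOn e (L * ω) := by
    have := marginalOn_localOp_mul_comm e R (L * ω)
    rw [← hL, ← mul_assoc, hLL] at this
    exact this.symm
  have h2 : marginalOn e (L * ω) = marginalOn e (ω * L) := marginalOn_localOp_mul_comm e R ω
  have e1 : sandwich (1 - L) ω = ω - L * ω - ω * L + L * ω * L := by
    rw [sandwich, conjTranspose_sub, hLh, conjTranspose_one]; noncomm_ring
  rw [e1, sandwich, hLh, marginalOn_add, marginalOn_sub, marginalOn_sub, h1, h2]
  abel

variable [DecidableEq Y]

lemma sandwich_localOp_prodOn (e : S ≃ X × Y) (G σ : Matrix X X ℂ) (θ : Matrix Y Y ℂ) :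
    sandwich (localOp e G) (prodOn e σ θ) = prodOn e (sandwich G σ) θ := by
  rw [sandwich, localOp_conjTranspose, localOp, localOp, prodOn_mul, prodOn_mul, one_mul, mul_one,
    sandwich]

lemma marginalOn_sandwich_localOp (e : S ≃ X × Y) (G : Matrix X X ℂ) (ω : Matrix S S ℂ) :
    marginalOn e (sandwich (localOp e G) ω) = sandwich G (marginalOn e ω) := by
  have h1 : marginalOn e (localOp e G * ω) = G * marginalOn e ω := by
    ext x x'
    simp only [marginalOn_apply, localOp_mul_apply]
    rw [mul_apply, Finset.sum_comm]
    simp only [marginalOn_apply, Finset.mul_sum]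
  have h2 (ω : Matrix S S ℂ) : marginalOn e (ω * localOp e Gᴴ) = marginalOn e ω * Gᴴ := by
    ext x x'
    simp only [marginalOn_apply, mul_localOp_apply]
    rw [mul_apply, Finset.sum_comm]
    simp only [marginalOn_apply, Finset.sum_mul]
  rw [sandwich, localOp_conjTranspose, h2, h1, sandwich]

lemma retr_sandwich_localOp (e : S ≃ X × Y) (G : Matrix X X ℂ) (ω : Matrix S S ℂ) :
    retr (sandwich (localOp e G) ω) = retr (sandwich G (marginalOn e ω)) := by
  rw [← marginalOn_sandwich_localOp, retr_marginalOn]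

variable [DecidableEq S] [DecidableEq X]

/-- If `V` moves the amplitude of `ω` by little, then so does `V` followed by a suitable local
operator that brings `σ` below `ρX`. -/
lemma exists_localOp {ω V : Matrix S S ℂ} (e : S ≃ X × Y) (hω : 0 ≤ ω) {ρX σ D : Matrix X X ℂ}
    (hρ : 0 ≤ ρX) (hD : 0 ≤ D) {δ k : ℝ} (hδ : 0 < δ) (hDδ : retr D ≤ 2 * δ)
    (hωD : marginalOn e ω ≤ ρX + D) (hσD : σ ≤ ρX + D)
    (hV : retr (sandwich (1 - V) ω) ≤ k * δ) :
    ∃ G, sandwich G σ ≤ ρX ∧ retr (sandwich (1 - localOp e G * V) ω) ≤ (18 + 10 * k) * δ := by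
  set E := sandwich (1 - V) ω with hE
  have hE0 : 0 ≤ E := sandwich_nonneg _ hω
  have hE1 := marginalOn_nonneg e hE0
  -- `G` is not assumed to be a contraction, so it might amplify the error `E` already made. Adding
  -- the marginal of `E` to `D` makes `G` gentle on `E` as well as on `ω`.
  obtain ⟨G, hG⟩ := exists_le_of_le_add (D := D + marginalOn e E) (d := (3 + k) * δ) hρ
    (add_nonneg hD hE1) (by rw [retr_add, retr_marginalOn]; linarith)
  have hDE : ρX + D ≤ ρX + (D + marginalOn e E) := by
    rw [← add_assoc]; exact le_add_of_nonneg_right hE1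
  refine ⟨G, (hG σ (hσD.trans hDE)).1, ?_⟩
  have hω1 := (hG _ (hωD.trans hDE)).2
  have hE2 := (hG (marginalOn e E) (by
    rw [← add_assoc]; exact le_add_of_nonneg_left (add_nonneg hρ hD))).2
  rw [← retr_sandwich_localOp, localOp_one_sub] at hω1 hE2
  rw [hE, sandwich_sandwich, ← sandwich_neg] at hE2
  -- The three terms cost `(3 + k) δ`, `k δ` and `(3 + k) δ`. Doubling for each sum gives `2 (3 + k)
  -- + 4 (k + 3 + k) = 18 + 10 k`.
  have e1 : 1 - localOp e G * V =
      (1 - localOp e G) + ((1 - V) + -((1 - localOp e G) * (1 - V))) := by noncomm_ring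
  rw [e1]
  have h1 := retr_sandwich_add_le (1 - localOp e G)
    ((1 - V) + -((1 - localOp e G) * (1 - V))) hω
  have h2 := retr_sandwich_add_le (1 - V) (-((1 - localOp e G) * (1 - V))) hω
  linarith

end Local

/-! ### From a bound by some product to a bound by the product of the marginals -/

section MarginalFix

lemma retr_sandwich_add_compl {S : Type*} [Fintype S] [DecidableEq S] {P : Matrix S S ℂ}
    (hP : Pᴴ = P) (hPP : P * P = P) (ω : Matrix S S ℂ) :
    retr (sandwich P ω) + retr (sandwich (1 - P) ω) = retr ω := by
  rw [retr_sandwich_of_proj hP hPP,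
    retr_sandwich_of_proj (compl_conjTranspose hP) (compl_mul_self hPP), sub_mul, retr_sub]
  simp

lemma prodOn_swap {S X Y : Type*} (e : S ≃ X × Y) (σ : Matrix X X ℂ) (θ : Matrix Y Y ℂ) :
    prodOn (e.trans (Equiv.prodComm X Y)) θ σ = prodOn e σ θ := by
  ext; simp [prodOn_apply, mul_comm]

variable {S X Y : Type*} [Fintype S] [Fintype X] [Fintype Y] [DecidableEq S] [DecidableEq X]
  [DecidableEq Y]

/-- If `ω` is dominated by a product of subnormalised operators, then it is dominated by the
product of the same operator on `Y` with its own marginal on `X`, after a gentle projection. -/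
lemma exists_proj_le_marginal (e : S ≃ X × Y) {ω : Matrix S S ℂ} {σ : Matrix X X ℂ}
    {θ : Matrix Y Y ℂ} (hω : 0 ≤ ω) (hσ : 0 ≤ σ) (hθ : 0 ≤ θ) (hσ1 : retr σ ≤ 1) {l η : ℝ}
    (hl : 0 ≤ l) (hη : 0 < η) (h : ω ≤ l • prodOn e σ θ) :
    ∃ Q, Qᴴ = Q ∧ Q * Q = Q ∧ retr (sandwich (1 - localOp e Q) ω) ≤ η ∧
      sandwich (localOp e Q) ω ≤
        (l / η) • prodOn e (marginalOn e (sandwich (localOp e Q) ω)) θ := by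
  -- Discard the part of `X` on which the marginal of `ω` is below `η σ`: this loses weight at most
  -- `η`, and on the rest `σ` is at most `η⁻¹` times the marginal.
  obtain ⟨Q, hQ, hQQ, h1, -, h2⟩ := exists_neyman_pearson (marginalOn_nonneg e hω) hσ hη.le
  refine ⟨Q, hQ, hQQ, ?_, ?_⟩
  · rw [← localOp_one_sub, retr_sandwich_localOp,
      retr_sandwich_of_proj (compl_conjTranspose hQ) (compl_mul_self hQQ)]
    nlinarith
  · have h3 := sandwich_mono (localOp e Q) h
    rw [sandwich_smul, sandwich_localOp_prodOn] at h3
    rw [marginalOn_sandwich_localOp]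
    refine h3.trans ?_
    have h4 := smul_mono (div_nonneg hl hη.le) (prodOn_mono_left e h1 hθ)
    rwa [prodOn_smul_left, smul_smul, div_mul_cancel₀ _ hη.ne'] at h4

/-- Two gentle projections replace `σ` and then `θ` by marginals, each costing a factor `q⁻²`. The
second one, `R` on `Y`, shrinks the marginal on `X` by `K`; adding a product operator with
`X`-marginal `K` restores it, and the marginal on `Y` can only grow. -/
lemma exists_close_le_marginals (e : S ≃ X × Y) {ω : Matrix S S ℂ} {σ : Matrix X X ℂ}
    {θ : Matrix Y Y ℂ} (hω : 0 ≤ ω) (hω1 : retr ω ≤ 1) (hω2 : 1 / 2 ≤ retr ω)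
    (hσ : 0 ≤ σ) (hθ : 0 ≤ θ) (hσ1 : retr σ ≤ 1) (hθ1 : retr θ ≤ 1) {l q : ℝ} (hl : 0 ≤ l)
    (hq : 0 < q) (hq1 : q ≤ 1 / 4) (h : ω ≤ l • prodOn e σ θ) :
    ∃ ω' : Matrix S S ℂ, 0 ≤ ω' ∧ retr ω' ≤ 1 ∧ Close (4 * q + 5 * q ^ 2) ω' ω ∧
      ω' ≤ (9 * l / q ^ 4) •
        prodOn e (marginalOn e ω') (marginalOn (e.trans (Equiv.prodComm X Y)) ω') := by
  set e' := e.trans (Equiv.prodComm X Y) with he'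
  have hη : 0 < q ^ 2 := by positivity
  have hη1 : q ^ 2 ≤ 1 / 16 := by nlinarith
  obtain ⟨Q, hQ, hQQ, hQ1, hQ2⟩ := exists_proj_le_marginal e hω hσ hθ hσ1 hl hη h
  set LQ := localOp e Q with hLQ
  set ω₁ := sandwich LQ ω with hω₁
  have hω₁0 : 0 ≤ ω₁ := sandwich_nonneg _ hω
  have hω₁X := marginalOn_nonneg e hω₁0
  have hQ3 : ω₁ ≤ (l / q ^ 2) • prodOn e' θ (marginalOn e ω₁) := by
    rw [he', prodOn_swap]; exact hQ2
  obtain ⟨R, hR, hRR, hR1, hR2⟩ := exists_proj_le_marginal e' hω₁0 hθ hω₁X hθ1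
    (div_nonneg hl hη.le) hη hQ3
  set LR := localOp e' R with hLR
  set ω₂ := sandwich LR ω₁ with hω₂
  have hω₂0 : 0 ≤ ω₂ := sandwich_nonneg _ hω₁0
  have hω₂Y := marginalOn_nonneg e' hω₂0
  rw [he', prodOn_swap, ← he'] at hR2
  have hsplit : marginalOn e ω₂ + marginalOn e (sandwich (1 - LR) ω₁) = marginalOn e ω₁ :=
    marginalOn_sandwich_add_compl e hR hRR ω₁
  set K := marginalOn e (sandwich (1 - LR) ω₁) with hK
  have hK0 : 0 ≤ K := marginalOn_nonneg e (sandwich_nonneg _ hω₁0)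
  have hK1 : retr K ≤ q ^ 2 := by rw [hK, retr_marginalOn]; exact hR1
  have hKle : K ≤ marginalOn e ω₁ := by
    rw [← hsplit]; exact le_add_of_nonneg_left (marginalOn_nonneg e hω₂0)
  have ht1 : retr ω₁ + retr (sandwich (1 - LQ) ω) = retr ω := retr_sandwich_add_compl
    (by rw [hLQ, localOp_conjTranspose, hQ]) (by rw [hLQ, localOp_mul, hQQ]) ω
  have ht1' : 0 ≤ retr (sandwich (1 - LQ) ω) := retr_nonneg (sandwich_nonneg _ hω)
  have ht2 : retr ω₂ + retr K = retr ω₁ := by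
    have := congrArg retr hsplit
    rwa [retr_add, retr_marginalOn e ω₂, retr_marginalOn e ω₁] at this
  set t := retr ω₂ with htdef
  have ht : 1 / 4 ≤ t := by linarith
  have ht0 : 0 < t := by linarith
  have hK2 := retr_nonneg hK0
  -- After division by `t`, the trace of its second factor, `N` has marginal exactly `K` on `X`, and
  -- its trace is at most `q ^ 2`.
  set N := prodOn e K (marginalOn e' ω₂) with hN
  have hN0 : 0 ≤ N := prodOn_nonneg e hK0 hω₂Y
  have hNX : marginalOn e N = t • K := by
    rw [hN, marginalOn_prodOn e K hω₂Y, retr_marginalOn]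
  have hNY : marginalOn e' N = retr K • marginalOn e' ω₂ := by
    rw [hN, ← prodOn_swap, ← he', marginalOn_prodOn e' _ hK0]
  have htN : 0 ≤ t⁻¹ • N := smul_nonneg' (inv_nonneg.2 ht0.le) hN0
  have hX : marginalOn e (ω₂ + t⁻¹ • N) = marginalOn e ω₁ := by
    rw [marginalOn_add, marginalOn_smul, hNX, smul_smul, inv_mul_cancel₀ ht0.ne', one_smul, hsplit]
  have hretr : retr (ω₂ + t⁻¹ • N) = retr ω₁ := by
    rw [← retr_marginalOn e, hX, retr_marginalOn]
  refine ⟨ω₂ + t⁻¹ • N, add_nonneg hω₂0 htN, by linarith, ?_, ?_⟩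
  · have hV : ω₂ = sandwich (LR * LQ) ω := by rw [hω₂, hω₁, sandwich_sandwich]
    have hc : retr (sandwich (1 - LR * LQ) ω) ≤ (2 * q) ^ 2 := by
      have e1 : 1 - LR * LQ = (1 - LQ) + (1 - LR) * LQ := by noncomm_ring
      rw [e1]
      have h1 := retr_sandwich_add_le (1 - LQ) ((1 - LR) * LQ) hω
      rw [← sandwich_sandwich] at h1
      nlinarith
    have hc2 := close_sandwich hω hω1 (by positivity) hc
    rw [← hV] at hc2
    have hc1 : Close (retr (ω₂ + t⁻¹ • N) - retr ω₂) (ω₂ + t⁻¹ • N) ω₂ :=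
      close_of_le (le_add_of_nonneg_right htN)
    refine (hc1.trans hc2).mono ?_
    rw [hretr]
    nlinarith
  · rw [hX]
    -- Taking traces bounds `l` from below, so the coefficient `t⁻¹ ≤ 4` of the correction is
    -- absorbed into `8 * l / q ^ 4`.
    have hl2 : 1 / 2 ≤ l := by
      have := retr_mono h
      rw [retr_smul, retr_prodOn e σ hθ] at this
      have h1 : retr θ * retr σ ≤ 1 := mul_le_one₀ hθ1 (retr_nonneg hσ) hσ1
      nlinarith
    have hti : t⁻¹ ≤ 4 := by rw [inv_le_comm₀ ht0 (by norm_num)]; linarith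
    have hP0 := prodOn_nonneg e hω₁X hω₂Y
    have hNle : t⁻¹ • N ≤ t⁻¹ • prodOn e (marginalOn e ω₁) (marginalOn e' ω₂) :=
      smul_mono (inv_nonneg.2 ht0.le) (prodOn_mono_left e hKle hω₂Y)
    refine (add_le_add hR2 hNle).trans ?_
    rw [← add_smul]
    have hcoef : l / q ^ 2 / q ^ 2 + t⁻¹ ≤ 9 * l / q ^ 4 := by
      have e1 : l / q ^ 2 / q ^ 2 = l / q ^ 4 := by field_simp
      have hq4 : q ^ 4 ≤ 1 := by
        have : q ^ 4 = q ^ 2 * q ^ 2 := by ring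
        nlinarith
      have e2 : 8 * l ≤ 8 * (l / q ^ 4) := by
        rw [mul_le_mul_iff_right₀ (by norm_num), le_div_iff₀ (by positivity)]
        nlinarith
      have e3 : 9 * l / q ^ 4 = 9 * (l / q ^ 4) := by ring
      rw [e1, e3]
      linarith
    refine (smul_mono_left hcoef hP0).trans
      (smul_mono (by positivity) (prodOn_mono_right e ?_ hω₁X))
    rw [marginalOn_add]
    exact le_add_of_nonneg_right (marginalOn_nonneg e' htN)

end MarginalFix

/-! ### The two marginals as instances of `marginalOn` -/

section Marginals

variable {X Y : Type*}

lemma marginalLeft_eq [Fintype Y] (ω : Matrix (X × Y) (X × Y) ℂ) :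
    marginalLeft ω = marginalOn (Equiv.refl (X × Y)) ω := rfl

lemma marginalRight_eq [Fintype X] (ω : Matrix (X × Y) (X × Y) ℂ) :
    marginalRight ω = marginalOn (Equiv.prodComm X Y) ω := rfl

lemma marginalLeft_nonneg [Fintype Y] {ω : Matrix (X × Y) (X × Y) ℂ} (h : 0 ≤ ω) :
    0 ≤ marginalLeft ω := by
  rw [marginalLeft_eq]; exact marginalOn_nonneg _ h

lemma marginalRight_nonneg [Fintype X] {ω : Matrix (X × Y) (X × Y) ℂ} (h : 0 ≤ ω) :
    0 ≤ marginalRight ω := by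
  rw [marginalRight_eq]; exact marginalOn_nonneg _ h

variable [Fintype X] [Fintype Y]

lemma kronecker_nonneg {σ : Matrix X X ℂ} {θ : Matrix Y Y ℂ} (hσ : 0 ≤ σ) (hθ : 0 ≤ θ) :
    0 ≤ σ ⊗ₖ θ :=
  prodOn_nonneg (Equiv.refl (X × Y)) hσ hθ

lemma retr_marginalLeft (ω : Matrix (X × Y) (X × Y) ℂ) : retr (marginalLeft ω) = retr ω := by
  rw [marginalLeft_eq, retr_marginalOn]

lemma retr_marginalRight (ω : Matrix (X × Y) (X × Y) ℂ) : retr (marginalRight ω) = retr ω := by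
  rw [marginalRight_eq, retr_marginalOn]

lemma Close.marginalLeft {d : ℝ} {ω ω' : Matrix (X × Y) (X × Y) ℂ} (h : Close d ω ω') :
    Close d (OneShot.marginalLeft ω) (OneShot.marginalLeft ω') := by
  rw [marginalLeft_eq, marginalLeft_eq]; exact h.marginalOn _

end Marginals

/-! ### The chain of local operators on a tripartite system -/

section Chain

/-- The splitting `AC : B` of the system `AB : C`. -/
def splitAC (A B C : Type*) : (A × B) × C ≃ (A × C) × B where
  toFun s := ((s.1.1, s.2), s.1.2)
  invFun s := ((s.1.1, s.2), s.1.2)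

/-- The splitting `A : BC` of the system `AB : C`. -/
def splitA (A B C : Type*) : (A × B) × C ≃ A × (B × C) := Equiv.prodAssoc A B C

/-- The splitting `B : AC` of the system `AB : C`. -/
def splitB (A B C : Type*) : (A × B) × C ≃ B × (A × C) where
  toFun s := (s.1.2, (s.1.1, s.2))
  invFun s := ((s.2.1, s.1), s.2.2)

variable {A B C : Type*}

lemma marginalOn_splitA [Fintype B] [Fintype C] (ρ : Matrix ((A × B) × C) ((A × B) × C) ℂ) :
    marginalOn (splitA A B C) ρ = marginalLeft (marginalAB ρ) := by
  ext a a'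
  rw [marginalOn_apply, Fintype.sum_prod_type]
  rfl

lemma marginalLeft_marginalAC [Fintype B] [Fintype C] (ρ : Matrix ((A × B) × C) ((A × B) × C) ℂ) :
    marginalLeft (marginalAC ρ) = marginalLeft (marginalAB ρ) := by
  ext a a'
  exact Finset.sum_comm

lemma marginalOn_splitB [Fintype A] [Fintype C] (ρ : Matrix ((A × B) × C) ((A × B) × C) ℂ) :
    marginalOn (splitB A B C) ρ = marginalRight (marginalAB ρ) := by
  ext b b'
  rw [marginalOn_apply, Fintype.sum_prod_type]
  rfl

variable [Fintype A] [Fintype B] [Fintype C] [DecidableEq A] [DecidableEq B] [DecidableEq C]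

/-- Each operator acts on one tensor factor of the current bound while the other factors are
spectators; `r1`, `r2` and `r3` regroup the product so that the next factor to be replaced stands
alone. -/
lemma sandwich_chain_le {ω : Matrix ((A × B) × C) ((A × B) × C) ℂ}
    {ωAC τ G₁ : Matrix (A × C) (A × C) ℂ}
    {ωB ρB G₃ : Matrix B B ℂ} {τA ρA G₂ : Matrix A A ℂ} {τC : Matrix C C ℂ}
    {ρAB P : Matrix (A × B) (A × B) ℂ} {la lb δ m : ℝ} (hωB0 : 0 ≤ ωB) (hρA0 : 0 ≤ ρA)
    (hτC0 : 0 ≤ τC) (hla : 0 ≤ la) (hlb : 0 ≤ lb) (hδ : 0 < δ) (hm : 0 < m)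
    (hτle : τ ≤ la • (τA ⊗ₖ τC)) (hωle : ω ≤ lb • prodOn (splitAC A B C) ωAC ωB)
    (hG₁ : sandwich G₁ ωAC ≤ τ) (hG₂ : sandwich G₂ τA ≤ ρA) (hG₃ : sandwich G₃ ωB ≤ ρB)
    (hP : (δ / m) • sandwich P (ρA ⊗ₖ ρB) ≤ sandwich P ρAB) :
    sandwich (localOp (Equiv.refl _) P * (localOp (splitB A B C) G₃ *
        (localOp (splitA A B C) G₂ * (localOp (splitAC A B C) G₁ * 1)))) ω ≤
      (la * lb * m / δ) • prodOn (Equiv.refl ((A × B) × C)) (sandwich P ρAB) τC := by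
  have r1 : prodOn (splitAC A B C) (τA ⊗ₖ τC) ωB = prodOn (splitA A B C) τA (ωB ⊗ₖ τC) := by
    ext s t
    simp only [prodOn_apply, splitAC, splitA, kroneckerMap_apply,
      Equiv.coe_fn_mk, Equiv.prodAssoc_apply]
    ring
  have r2 : prodOn (splitA A B C) ρA (ωB ⊗ₖ τC) = prodOn (splitB A B C) ωB (ρA ⊗ₖ τC) := by
    ext s t
    simp only [prodOn_apply, splitB, splitA, kroneckerMap_apply,
      Equiv.coe_fn_mk, Equiv.prodAssoc_apply]
    ring
  have r3 : prodOn (splitB A B C) ρB (ρA ⊗ₖ τC) =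
      prodOn (Equiv.refl ((A × B) × C)) (ρA ⊗ₖ ρB) τC := by
    ext s t
    simp only [prodOn_apply, splitB, kroneckerMap_apply, Equiv.coe_fn_mk, Equiv.refl_apply]
    ring
  have hll := mul_nonneg hla hlb
  have s1 : sandwich (localOp (splitAC A B C) G₁) ω ≤
      (la * lb) • prodOn (splitA A B C) τA (ωB ⊗ₖ τC) := by
    refine (sandwich_mono _ hωle).trans ?_
    rw [sandwich_smul, sandwich_localOp_prodOn, ← r1, mul_comm, ← smul_smul,
      ← prodOn_smul_left _ la]
    exact smul_mono hlb (prodOn_mono_left _ (hG₁.trans hτle) hωB0)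
  have s2 := sandwich_mono (localOp (splitA A B C) G₂) s1
  rw [sandwich_smul, sandwich_localOp_prodOn] at s2
  replace s2 := s2.trans (smul_mono hll (prodOn_mono_left _ hG₂
    (prodOn_nonneg (Equiv.refl (B × C)) hωB0 hτC0)))
  rw [r2] at s2
  have s3 := sandwich_mono (localOp (splitB A B C) G₃) s2
  rw [sandwich_smul, sandwich_localOp_prodOn] at s3
  replace s3 := s3.trans (smul_mono hll (prodOn_mono_left _ hG₃
    (prodOn_nonneg (Equiv.refl (A × C)) hρA0 hτC0)))
  rw [r3] at s3
  have s4 := sandwich_mono (localOp (Equiv.refl ((A × B) × C)) P) s3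
  rw [sandwich_smul, sandwich_localOp_prodOn] at s4
  simp only [sandwich_sandwich] at s4
  rw [mul_one]
  refine s4.trans ?_
  have hc : 0 ≤ la * lb * m / δ := by positivity
  have s5 := smul_mono hc (prodOn_mono_left (Equiv.refl ((A × B) × C)) hP hτC0)
  rw [prodOn_smul_left, smul_smul] at s5
  convert s5 using 2
  field_simp

/-- Neyman–Pearson optimality against `T` at threshold `δ / m` costs `δ` from the first test error
and `2 δ` from the second; passing from `ρ` to `ω` costs another `δ`. -/
lemma exists_proj_of_test {S : Type*} [Fintype S] [DecidableEq S] {ρ σ ω T : Matrix S S ℂ}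
    (hρ : 0 ≤ ρ) (hσ : 0 ≤ σ) (hρ1 : retr ρ = 1) {δ m : ℝ} (hωρ : Close δ ω ρ) (hδ : 0 < δ)
    (hm : 0 < m) (hT : 0 ≤ T) (hT1 : T ≤ 1) (hTρ : 1 - δ ≤ retr (T * ρ))
    (hTσ : retr (T * σ) ≤ 2 * m) :
    ∃ P : Matrix S S ℂ, Pᴴ = P ∧ P * P = P ∧ (δ / m) • sandwich P σ ≤ sandwich P ρ ∧
      retr ((1 - P) * ω) ≤ 4 * δ := by
  have hμ : 0 < δ / m := div_pos hδ hm
  obtain ⟨P, hP, hPP, hP1, hP2, -⟩ := exists_neyman_pearson hρ hσ hμ.le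
  refine ⟨P, hP, hPP, hP1, ?_⟩
  have hPρ : retr ((1 - P) * ρ) ≤ 3 * δ := by
    have h1 := hP2 T hT hT1
    have h2 : δ / m * retr (T * σ) ≤ 2 * δ := by
      refine (mul_le_mul_of_nonneg_left hTσ hμ.le).trans_eq ?_
      field_simp
    rw [sub_mul, retr_sub, one_mul, hρ1]
    linarith
  obtain ⟨D, hD, hD', -, hDt⟩ := hωρ.exists_le_add
  have h1 := retr_proj_mul_mono (compl_conjTranspose hP) (compl_mul_self hPP) hD'
  have h2 := retr_proj_mul_mono hP hPP hD
  have h3 : retr ((1 - P) * D) = retr D - retr (P * D) := by rw [sub_mul, retr_sub, one_mul]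
  rw [mul_zero, retr_zero] at h2
  rw [mul_add, retr_add] at h1
  linarith

/-- Unlike the operators `G`, a projection does not increase the error already made. -/
lemma retr_sandwich_compl_proj_mul_le {S : Type*} [Fintype S] [DecidableEq S]
    {P V ω : Matrix S S ℂ} (hP : Pᴴ = P) (hPP : P * P = P) (hω : 0 ≤ ω) :
    retr (sandwich (1 - P * V) ω) ≤
      2 * (retr (sandwich (1 - P) ω) + retr (sandwich (1 - V) ω)) := by
  have e1 : 1 - P * V = (1 - P) + P * (1 - V) := by noncomm_ring
  rw [e1]
  have h1 := retr_sandwich_add_le (1 - P) (P * (1 - V)) hω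
  rw [← sandwich_sandwich] at h1
  have hE := sandwich_nonneg (1 - V) hω
  have h2 := retr_sandwich_add_compl hP hPP (sandwich (1 - V) ω)
  have h3 := retr_nonneg (sandwich_nonneg (1 - P) hE)
  linarith

/-- The chain of local operators: `ω` can be moved gently below a product of a part of `ρ^{AB}`
with `τ^C`. -/
lemma exists_sandwich_le {ρ ω : Matrix ((A × B) × C) ((A × B) × C) ℂ}
    {τ : Matrix (A × C) (A × C) ℂ} (hρ : 0 ≤ ρ) (hρ1 : retr ρ = 1) (hω : 0 ≤ ω) (hτ : 0 ≤ τ)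
    {δ m la lb : ℝ} (hδ : 0 < δ) (hm : 0 < m) (hla : 0 ≤ la) (hlb : 0 ≤ lb)
    (hτρ : Close δ τ (marginalAC ρ)) (hωρ : Close δ ω ρ)
    (hτle : τ ≤ la • (marginalLeft τ ⊗ₖ marginalRight τ))
    (hωle : ω ≤ lb • prodOn (splitAC A B C) (marginalOn (splitAC A B C) ω)
      (marginalOn (splitB A B C) ω))
    {T : Matrix (A × B) (A × B) ℂ} (hT : 0 ≤ T) (hT1 : T ≤ 1)
    (hTρ : 1 - δ ≤ retr (T * marginalAB ρ))
    (hTσ : retr (T * (marginalLeft (marginalAB ρ) ⊗ₖ marginalRight (marginalAB ρ))) ≤ 2 * m) :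
    ∃ V σ, 0 ≤ σ ∧ retr σ ≤ 1 ∧ retr (sandwich (1 - V) ω) ≤ 4004 * δ ∧
      sandwich V ω ≤ (la * lb * m / δ) • prodOn (Equiv.refl ((A × B) × C)) σ (marginalRight τ) := by
  set ρAB := marginalAB ρ with hρAB
  set ρA := marginalLeft ρAB with hρA
  set ρB := marginalRight ρAB with hρB
  set ωB := marginalOn (splitB A B C) ω with hωB
  have hρAB0 : 0 ≤ ρAB := by rw [hρAB, marginalAB]; exact marginalLeft_nonneg hρ
  have hρA0 : 0 ≤ ρA := marginalLeft_nonneg hρAB0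
  have hρB0 : 0 ≤ ρB := marginalRight_nonneg hρAB0
  have hτC0 : 0 ≤ marginalRight τ := marginalRight_nonneg hτ
  have hωB0 : 0 ≤ ωB := marginalOn_nonneg (splitB A B C) hω
  have hρAB1 : retr ρAB = 1 := by rw [hρAB, marginalAB, retr_marginalLeft, hρ1]
  have hωAB : Close δ (marginalLeft ω) ρAB := by rw [hρAB, marginalAB]; exact hωρ.marginalLeft
  -- from `ω^{AC}` to `τ^{AC}`
  obtain ⟨D₁, hD₁, hD₁', -, hD₁t⟩ :=
    ((hωρ.marginalOn (splitAC A B C)).trans hτρ.symm).exists_le_add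
  -- The errors develop by `k ↦ 18 + 10 k` from `k = 0`: `18`, `198`, `1998`. The projection then
  -- gives `2 (4 + 1998) = 4004`.
  obtain ⟨G₁, hG₁, hV₁⟩ := exists_localOp (V := 1) (k := 0) (splitAC A B C) hω hτ hD₁ hδ
    (by linarith) hD₁' hD₁' (by simp [sandwich])
  -- from `τ^A` to `ρ^A`
  obtain ⟨D₂, hD₂, hD₂', -, hD₂t⟩ := (hωρ.marginalOn (splitA A B C)).exists_le_add
  obtain ⟨D₃, hD₃, hD₃', -, hD₃t⟩ := hτρ.marginalLeft.exists_le_add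
  rw [marginalOn_splitA ρ] at hD₂'
  rw [marginalLeft_marginalAC ρ] at hD₃'
  have hωA : marginalOn (splitA A B C) ω ≤ ρA + (D₂ + D₃) := by
    rw [← add_assoc]
    exact hD₂'.trans (le_add_of_nonneg_right hD₃)
  have hτA : marginalLeft τ ≤ ρA + (D₂ + D₃) :=
    hD₃'.trans (add_le_add le_rfl (le_add_of_nonneg_left hD₂))
  obtain ⟨G₂, hG₂, hV₂⟩ := exists_localOp (splitA A B C) hω hρA0 (add_nonneg hD₂ hD₃) hδ
    (by rw [retr_add]; linarith) hωA hτA hV₁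
  -- from `ω^B` to `ρ^B`
  obtain ⟨D₄, hD₄, hD₄', -, hD₄t⟩ := (hωρ.marginalOn (splitB A B C)).exists_le_add
  rw [marginalOn_splitB ρ] at hD₄'
  obtain ⟨G₃, hG₃, hV₃⟩ := exists_localOp (splitB A B C) hω hρB0 hD₄ hδ (by linarith) hD₄' hD₄' hV₂
  -- from `ρ^A ⊗ ρ^B` to `ρ^{AB}`
  have hσ0 : 0 ≤ ρA ⊗ₖ ρB := kronecker_nonneg hρA0 hρB0
  obtain ⟨P, hP, hPP, hP1, hPω⟩ := exists_proj_of_test hρAB0 hσ0 hρAB1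
    hωAB hδ hm hT hT1 hTρ hTσ
  replace hPω : retr (sandwich (1 - localOp (Equiv.refl ((A × B) × C)) P) ω) ≤ 4 * δ := by
    rw [← localOp_one_sub, retr_sandwich_localOp,
      retr_sandwich_of_proj (compl_conjTranspose hP) (compl_mul_self hPP), ← marginalLeft_eq]
    exact hPω
  set V₃ := localOp (splitB A B C) G₃ *
    (localOp (splitA A B C) G₂ * (localOp (splitAC A B C) G₁ * 1)) with hV₃def
  have hPρ0 := sandwich_nonneg P hρAB0
  refine ⟨localOp (Equiv.refl ((A × B) × C)) P * V₃, sandwich P ρAB, hPρ0, ?_, ?_, ?_⟩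
  · have h1 := retr_sandwich_add_compl hP hPP ρAB
    have h2 := retr_nonneg (sandwich_nonneg (1 - P) hρAB0)
    linarith
  · have h1 := retr_sandwich_compl_proj_mul_le (V := V₃)
      (P := localOp (Equiv.refl ((A × B) × C)) P)
      (by rw [localOp_conjTranspose, hP]) (by rw [localOp_mul, hPP]) hω
    linarith
  · exact sandwich_chain_le hωB0 hρA0 hτC0 hla hlb hδ hm hτle hωle hG₁ hG₂ hG₃ hP1

/-- The chain rule for operator inequalities. -/
lemma exists_close_chain {ρ : Matrix ((A × B) × C) ((A × B) × C) ℂ}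
    {τ : Matrix (A × C) (A × C) ℂ} {ω : Matrix (B × (A × C)) (B × (A × C)) ℂ}
    (hρ : 0 ≤ ρ) (hρ1 : retr ρ = 1) (hω : 0 ≤ ω) (hω1 : retr ω ≤ 1) (hτ : 0 ≤ τ)
    (hτ1 : retr τ ≤ 1) {q m la lb : ℝ} (hq : 0 < q) (hq1 : q ≤ 1 / 1000) (hm : 0 < m)
    (hla : 0 ≤ la) (hlb : 0 ≤ lb) (hτρ : Close (q ^ 2) τ (marginalAC ρ))
    (hωρ : Close (q ^ 2) ω (regroup ρ))
    (hτle : τ ≤ la • (marginalLeft τ ⊗ₖ marginalRight τ))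
    (hωle : ω ≤ lb • (marginalLeft ω ⊗ₖ marginalRight ω))
    {T : Matrix (A × B) (A × B) ℂ} (hT : 0 ≤ T) (hT1 : T ≤ 1)
    (hTρ : 1 - q ^ 2 ≤ retr (T * marginalAB ρ))
    (hTσ : retr (T * (marginalLeft (marginalAB ρ) ⊗ₖ marginalRight (marginalAB ρ))) ≤ 2 * m) :
    ∃ ω' : Matrix ((A × B) × C) ((A × B) × C) ℂ, 0 ≤ ω' ∧ retr ω' ≤ 1 ∧
      Close (1000 * q) ω' ρ ∧
      ω' ≤ (9 * (la * lb * m) / q ^ 6) • (marginalLeft ω' ⊗ₖ marginalRight ω') := by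
  have hδ : 0 < q ^ 2 := by positivity
  have hq2 : q ^ 2 ≤ q / 1000 := by nlinarith
  set e := splitB A B C
  set ω₀ := ω.submatrix e e with hω₀
  have hω₀0 : 0 ≤ ω₀ := nonneg_iff_posSemidef.2 ((nonneg_iff_posSemidef.1 hω).submatrix e)
  have hω₀1 : retr ω₀ ≤ 1 := by rwa [hω₀, retr_submatrix]
  have hω₀ρ : Close (q ^ 2) ω₀ ρ := hωρ.submatrix e
  have hω₀le : ω₀ ≤ lb • prodOn (splitAC A B C) (marginalOn (splitAC A B C) ω₀)
      (marginalOn e ω₀) := by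
    have h1 := le_iff.2 ((le_iff.1 hωle).submatrix e)
    refine h1.trans_eq ?_
    ext s t
    exact congrArg (fun z : ℂ => lb • z) (mul_comm _ _)
  obtain ⟨V, σ, hσ, hσ1, hV1, hV2⟩ := exists_sandwich_le hρ hρ1 hω₀0 hτ hδ hm hla hlb hτρ hω₀ρ
    hτle hω₀le hT hT1 hTρ hTσ
  -- The choice of `64` rests on `64 ^ 2 = 4096 ≥ 4004`.
  have hc := close_sandwich (V := V) hω₀0 hω₀1 (q := 64 * q) (by positivity) (by nlinarith)
  set r := 2 * (64 * q) + (64 * q) ^ 2 with hr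
  have hr0 : 0 < r := by positivity
  have hr1 : r ≤ 133 * q := by nlinarith
  set ω₁ := sandwich V ω₀ with hω₁
  have hω₁0 : 0 ≤ ω₁ := sandwich_nonneg V hω₀0
  have hω₁1 : retr ω₁ ≤ 1 + r := hc.retr_le.trans (by linarith)
  have hinv : (1 + r)⁻¹ ≤ 1 := inv_le_one_of_one_le₀ (by linarith)
  have hinv0 : 0 ≤ (1 + r)⁻¹ := by positivity
  -- Conjugation by `V` may raise the trace above one; rescaling makes the operator subnormalised
  -- again.
  set ω₂ := (1 + r)⁻¹ • ω₁ with hω₂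
  have hω₂0 : 0 ≤ ω₂ := smul_nonneg' hinv0 hω₁0
  have hω₂le : ω₂ ≤ ω₁ := by simpa using smul_mono_left hinv hω₁0
  have hω₂1 : retr ω₂ ≤ 1 := by
    rw [hω₂, retr_smul, inv_mul_le_iff₀ (by positivity), mul_one]; exact hω₁1
  have hc2 : Close r ω₁ ω₂ := by
    refine (close_of_le hω₂le).mono ?_
    have e1 : (1 + r) * (1 + r)⁻¹ = 1 := mul_inv_cancel₀ (by positivity)
    have e2 : retr ω₁ - (1 + r)⁻¹ * retr ω₁ = r * ((1 + r)⁻¹ * retr ω₁) := by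
      linear_combination (-retr ω₁) * e1
    rw [hω₂, retr_smul] at hω₂1 ⊢
    rw [e2]
    exact mul_le_of_le_one_right hr0.le hω₂1
  have hc3 : Close (r + (r + q ^ 2)) ω₂ ρ := hc2.symm.trans (hc.trans hω₀ρ)
  have hω₂2 : 1 / 2 ≤ retr ω₂ := by
    have := hc3.symm.retr_le
    linarith
  have hτC0 : 0 ≤ marginalRight τ := marginalRight_nonneg hτ
  have hτC1 : retr (marginalRight τ) ≤ 1 := (retr_marginalRight τ).trans_le hτ1
  obtain ⟨ω₃, h0, h1, h2, h3⟩ := exists_close_le_marginals (Equiv.refl _) hω₂0 hω₂1 hω₂2 hσ hτC0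
    hσ1 hτC1 (by positivity) hq (by linarith) (hω₂le.trans hV2)
  refine ⟨ω₃, h0, h1, (h2.trans hc3).mono (by linarith), h3.trans_eq ?_⟩
  have e1 : 9 * (la * lb * m / q ^ 2) / q ^ 4 = 9 * (la * lb * m) / q ^ 6 := by
    field_simp
  rw [e1]
  rfl

end Chain

/-! ### Smooth entropies: admissible operators and finiteness -/

section Entropies

variable {X Y : Type*} [Fintype X] [Fintype Y]

lemma IsState.nonneg {ρ : Matrix X X ℂ} (h : IsState ρ) : 0 ≤ ρ := nonneg_iff_posSemidef.2 h.1

lemma IsState.retr_eq_one {ρ : Matrix X X ℂ} (h : IsState ρ) : retr ρ = 1 := by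
  rw [retr, h.2, Complex.one_re]

lemma retr_kronecker (σ : Matrix X X ℂ) {θ : Matrix Y Y ℂ} (hθ : 0 ≤ θ) :
    retr (σ ⊗ₖ θ) = retr θ * retr σ :=
  retr_prodOn (Equiv.refl (X × Y)) σ hθ

/-- Taking traces gives `t ≤ c t ^ 2` for `t = retr τ`. This is what excludes coefficients below one
for subnormalised operators. -/
lemma one_le_mul_retr_of_le {τ : Matrix (X × Y) (X × Y) ℂ} (hτ : 0 ≤ τ) {c : ℝ}
    (h : τ ≤ c • (marginalLeft τ ⊗ₖ marginalRight τ)) (h0 : 0 < retr τ) : 1 ≤ c * retr τ := by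
  have h1 := retr_mono h
  rw [retr_smul, retr_kronecker _ (marginalRight_nonneg hτ), retr_marginalLeft,
    retr_marginalRight] at h1
  by_contra! h2
  nlinarith

variable [DecidableEq X] [DecidableEq Y]

lemma mem_ball_iff {ε : ℝ} {τ ρ : Matrix X X ℂ} (hρ : 0 ≤ ρ) :
    τ ∈ ball ε ρ ↔ 0 ≤ τ ∧ Close ε τ ρ ∧ retr τ ≤ 1 := by
  have hρ' := (nonneg_iff_posSemidef.1 hρ).isHermitian
  rw [nonneg_iff_posSemidef]
  constructor
  · rintro ⟨h1, h2, h3⟩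
    exact ⟨h1, close_of_traceNorm_le h1.isHermitian hρ' h2, h3⟩
  · rintro ⟨h1, h2, h3⟩
    exact ⟨h1, h2.traceNorm_le h1.isHermitian hρ', h3⟩

lemma smoothImax_le {ε : ℝ} {ρ τ : Matrix (X × Y) (X × Y) ℂ} (hτ : τ ∈ ball ε ρ) {c : ℝ}
    (hc : 0 < c) (h : τ ≤ c • (marginalLeft τ ⊗ₖ marginalRight τ)) :
    smoothImax ε ρ ≤ (Real.logb 2 c : ℝ) := by
  refine (iInf₂_le τ hτ).trans (iInf₂_le (Real.logb 2 c) ?_)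
  rw [Real.rpow_logb (by norm_num) (by norm_num) hc, Complex.coe_smul]
  exact le_iff.1 h

lemma exists_of_smoothImax_lt {ε : ℝ} {ρ : Matrix (X × Y) (X × Y) ℂ} {x : EReal}
    (h : smoothImax ε ρ < x) : ∃ τ ∈ ball ε ρ, ∃ l : ℝ, (l : EReal) < x ∧
      τ ≤ ((2 : ℝ) ^ l) • (marginalLeft τ ⊗ₖ marginalRight τ) := by
  simp only [smoothImax, Imax, Dmax, iInf_lt_iff] at h
  obtain ⟨τ, hτ, l, hl, hlx⟩ := h
  rw [Complex.coe_smul] at hl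
  exact ⟨τ, hτ, l, hlx, le_iff.2 hl⟩

lemma smoothImax_ne_bot {ε : ℝ} (hε : ε < 1) {ρ : Matrix (X × Y) (X × Y) ℂ} (hρ : 0 ≤ ρ)
    (hρ1 : retr ρ = 1) : smoothImax ε ρ ≠ ⊥ := by
  intro hbot
  obtain ⟨τ, hτ, l, hl, hle⟩ :=
    exists_of_smoothImax_lt (x := 0) (by rw [hbot]; exact EReal.bot_lt_zero)
  obtain ⟨h0, h1, h2⟩ := (mem_ball_iff hρ).1 hτ
  have h3 := h1.symm.retr_le
  have h4 := one_le_mul_retr_of_le h0 hle (by linarith)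
  have h5 : (2 : ℝ) ^ l < 1 :=
    Real.rpow_lt_one_of_one_lt_of_neg (by norm_num) (by exact_mod_cast hl)
  nlinarith

lemma exists_le_smul_one {ω : Matrix X X ℂ} (hω : 0 ≤ ω) :
    ∃ M : ℝ, 0 ≤ M ∧ ω ≤ M • (1 : Matrix X X ℂ) := by
  have hH := (nonneg_iff_posSemidef.1 hω)
  set ev := hH.isHermitian.eigenvalues with hev
  have h0 : ∀ i, 0 ≤ ev i := hH.eigenvalues_nonneg
  set U : Matrix X X ℂ := (hH.isHermitian.eigenvectorUnitary : Matrix X X ℂ) with hU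
  have hUU : U * Uᴴ = 1 := Unitary.coe_mul_star_self hH.isHermitian.eigenvectorUnitary
  have hs : ω = sandwich U (diagonal fun i => (ev i : ℂ)) := by
    conv_lhs => rw [hH.isHermitian.spectral_theorem, Unitary.conjStarAlgAut_apply]
    rfl
  refine ⟨∑ i, ev i, Finset.sum_nonneg fun i _ => h0 i, ?_⟩
  have e : (∑ i, ev i) • (1 : Matrix X X ℂ) - ω =
      sandwich U (diagonal fun i => (((∑ j, ev j) - ev i : ℝ) : ℂ)) := by
    have e1 : (1 : Matrix X X ℂ) = sandwich U 1 := by simp [sandwich, hUU]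
    conv_lhs => rw [hs, e1, ← sandwich_smul, ← sandwich_sub]
    congr 1
    ext i j
    by_cases hij : i = j
    · subst hij; simp
    · simp [hij]
  rw [← sub_nonneg, e]
  refine sandwich_nonneg _ (nonneg_iff_posSemidef.2 (PosSemidef.diagonal fun i => ?_))
  rw [Pi.zero_apply, Complex.zero_le_real, sub_nonneg]
  exact Finset.single_le_sum (fun j _ => h0 j) (Finset.mem_univ i)

lemma maximallyMixed_nonneg_retr_le (hX : (0 : ℝ) < Fintype.card X) :
    0 ≤ (Fintype.card X : ℝ)⁻¹ • (1 : Matrix X X ℂ) ∧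
      retr ((Fintype.card X : ℝ)⁻¹ • (1 : Matrix X X ℂ)) ≤ 1 := by
  refine ⟨smul_nonneg' (by positivity) (nonneg_iff_posSemidef.2 .one), ?_⟩
  rw [retr_smul, retr, trace_one, Complex.natCast_re, inv_mul_cancel₀ hX.ne']

/-- A large multiple of the product of the maximally mixed states dominates `ρ`, so the repair of
marginals provides an operator in the ball with finite `Imax`. -/
lemma smoothImax_ne_top {ε : ℝ} (hε : 0 < ε) {ρ : Matrix (X × Y) (X × Y) ℂ} (hρ : 0 ≤ ρ)
    (hρ1 : retr ρ = 1) : smoothImax ε ρ ≠ ⊤ := by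
  have hne : Nonempty (X × Y) := by
    by_contra h
    rw [not_nonempty_iff] at h
    simp [retr, trace] at hρ1
  obtain ⟨x, y⟩ := hne
  have hX : (0 : ℝ) < Fintype.card X := by exact_mod_cast Fintype.card_pos_iff.2 ⟨x⟩
  have hY : (0 : ℝ) < Fintype.card Y := by exact_mod_cast Fintype.card_pos_iff.2 ⟨y⟩
  have hX' := maximallyMixed_nonneg_retr_le hX
  have hY' := maximallyMixed_nonneg_retr_le hY
  obtain ⟨M, hM, hle⟩ := exists_le_smul_one hρ
  have hprod : ρ ≤ (M * (Fintype.card X * Fintype.card Y)) • prodOn (Equiv.refl (X × Y))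
      ((Fintype.card X : ℝ)⁻¹ • (1 : Matrix X X ℂ))
      ((Fintype.card Y : ℝ)⁻¹ • (1 : Matrix Y Y ℂ)) := by
    rw [prodOn_smul_left, prodOn_smul_right, smul_smul, smul_smul, prodOn, one_kronecker_one,
      submatrix_one_equiv]
    convert hle using 2
    field_simp
  set q := min (1 / 4) (ε / 10) with hq
  have hq0 : 0 < q := lt_min (by norm_num) (by positivity)
  have hq1 : q ≤ 1 / 4 := min_le_left _ _
  have hq2 : q ≤ ε / 10 := min_le_right _ _
  obtain ⟨τ, h0, h1, h2, h3⟩ := exists_close_le_marginals (Equiv.refl (X × Y)) hρ hρ1.le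
    (by rw [hρ1]; norm_num) hX'.1 hY'.1 hX'.2 hY'.2 (by positivity) hq0 hq1 hprod
  set c := 9 * (M * (Fintype.card X * Fintype.card Y)) / q ^ 4 with hc
  have hc0 : 0 ≤ c := by positivity
  have h4 : τ ≤ (c + 1) • (marginalLeft τ ⊗ₖ marginalRight τ) :=
    h3.trans (smul_mono_left (by linarith)
      (kronecker_nonneg (marginalLeft_nonneg h0) (marginalRight_nonneg h0)))
  have h2' : Close ε τ ρ := h2.mono (by nlinarith)
  have h5 := smoothImax_le ((mem_ball_iff hρ).2 ⟨h0, h2', h1⟩) (by linarith) h4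
  exact ne_top_of_le_ne_top (EReal.coe_ne_top _) h5

lemma smoothImax_eq_bot {ε : ℝ} (hε : 1 ≤ ε) {ρ : Matrix (X × Y) (X × Y) ℂ} (hρ : 0 ≤ ρ)
    (hρ1 : retr ρ = 1) : smoothImax ε ρ = ⊥ := by
  have h0 : (0 : Matrix (X × Y) (X × Y) ℂ) ∈ ball ε ρ := by
    refine (mem_ball_iff hρ).2 ⟨le_rfl, ?_, by simp⟩
    have := (close_of_le hρ).symm
    rw [hρ1, retr_zero, sub_zero] at this
    exact this.mono hε
  rw [EReal.eq_bot_iff_forall_lt]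
  intro y
  have h1 : (0 : Matrix (X × Y) (X × Y) ℂ) ≤ ((2 : ℝ) ^ (y - 1)) •
      (marginalLeft (0 : Matrix (X × Y) (X × Y) ℂ) ⊗ₖ
        marginalRight (0 : Matrix (X × Y) (X × Y) ℂ)) :=
    smul_nonneg' (by positivity)
      (kronecker_nonneg (marginalLeft_nonneg le_rfl) (marginalRight_nonneg le_rfl))
  have h2 := smoothImax_le h0 (by positivity) h1
  rw [Real.logb_rpow (by norm_num) (by norm_num)] at h2
  exact h2.trans_lt (by exact_mod_cast sub_one_lt y)

lemma exists_test {δ : ℝ} (hδ : 0 ≤ δ) {ρ σ : Matrix X X ℂ} (hρ1 : retr ρ = 1) {x : ℝ}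
    (hx : minError δ ρ σ < x) :
    ∃ T : Matrix X X ℂ, 0 ≤ T ∧ T ≤ 1 ∧ 1 - δ ≤ retr (T * ρ) ∧ retr (T * σ) ≤ x := by
  obtain ⟨t, ⟨T, h1, h2, h3, rfl⟩, hlt⟩ := exists_lt_of_csInf_lt (s := {t : ℝ | ∃ T : Matrix X X ℂ,
    T.PosSemidef ∧ (1 - T).PosSemidef ∧ 1 - δ ≤ (T * ρ).trace.re ∧ t = (T * σ).trace.re})
    ⟨_, 1, .one, by simpa using PosSemidef.zero, by
      rw [one_mul]; change 1 - δ ≤ retr ρ; linarith, rfl⟩ hx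
  exact ⟨T, nonneg_iff_posSemidef.2 h1, le_iff.2 h2, h3, hlt.le⟩

end Entropies

/-! ### The chain rule -/

section Main

variable {A B C : Type*} [Fintype A] [Fintype B] [Fintype C]

lemma retr_regroup (ρ : Matrix ((A × B) × C) ((A × B) × C) ℂ) : retr (regroup ρ) = retr ρ :=
  retr_submatrix (splitB A B C).symm ρ

variable [DecidableEq A] [DecidableEq B] [DecidableEq C]

/-- The chain of operator inequalities, for admissible operators of the two smooth max mutual
informations and any upper bound on the error of the hypothesis test. -/
lemma exists_mem_ball_le {ρ : Matrix ((A × B) × C) ((A × B) × C) ℂ} (hρ : 0 ≤ ρ)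
    (hρ1 : retr ρ = 1) {q : ℝ} (hq : 0 < q) (hq1 : q ≤ 1 / 1000)
    {τ : Matrix (A × C) (A × C) ℂ} (hτ : τ ∈ ball (q ^ 2) (marginalAC ρ))
    {ω : Matrix (B × (A × C)) (B × (A × C)) ℂ} (hω : ω ∈ ball (q ^ 2) (regroup ρ)) {a b m : ℝ}
    (hτle : τ ≤ ((2 : ℝ) ^ a) • (marginalLeft τ ⊗ₖ marginalRight τ))
    (hωle : ω ≤ ((2 : ℝ) ^ b) • (marginalLeft ω ⊗ₖ marginalRight ω)) (hm : 0 < m)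
    (hlt : minError (q ^ 2) (marginalAB ρ)
      (marginalLeft (marginalAB ρ) ⊗ₖ marginalRight (marginalAB ρ)) < 2 * m) :
    ∃ ω' ∈ ball (1000 * q) ρ, ω' ≤ (9 * ((2 : ℝ) ^ a * (2 : ℝ) ^ b * m) / q ^ 6) •
      (marginalLeft ω' ⊗ₖ marginalRight ω') := by
  have hreg : 0 ≤ regroup ρ :=
    nonneg_iff_posSemidef.2 ((nonneg_iff_posSemidef.1 hρ).submatrix _)
  have hAC : 0 ≤ marginalAC ρ := by rw [marginalAC]; exact marginalRight_nonneg hreg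
  have hAB1 : retr (marginalAB ρ) = 1 := by rw [marginalAB, retr_marginalLeft, hρ1]
  obtain ⟨hτ0, hτρ, hτ1⟩ := (mem_ball_iff hAC).1 hτ
  obtain ⟨hω0, hωρ, hω1⟩ := (mem_ball_iff hreg).1 hω
  obtain ⟨T, hT, hT1, hTρ, hTσ⟩ := exists_test (by positivity) hAB1 hlt
  obtain ⟨ω', h0, h1, h2, h3⟩ := exists_close_chain hρ hρ1 hω0 hω1 hτ0 hτ1 hq hq1 hm
    (by positivity) (by positivity) hτρ hωρ hτle hωle hT hT1 hTρ hTσ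
  exact ⟨ω', (mem_ball_iff hρ).2 ⟨h0, h2, h1⟩, h3⟩

/-- Needed for `IH` to be finite. Were the minimal error zero, `m` could be taken arbitrarily small
in the chain of inequalities, and the coefficient would drop below the bound that traces impose. -/
lemma minError_marginalAB_pos {ρ : Matrix ((A × B) × C) ((A × B) × C) ℂ} (hρ : 0 ≤ ρ)
    (hρ1 : retr ρ = 1) {q : ℝ} (hq : 0 < q) (hq1 : q < 1 / 1000) :
    0 < minError (q ^ 2) (marginalAB ρ)
      (marginalLeft (marginalAB ρ) ⊗ₖ marginalRight (marginalAB ρ)) := by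
  have hreg : 0 ≤ regroup ρ :=
    nonneg_iff_posSemidef.2 ((nonneg_iff_posSemidef.1 hρ).submatrix _)
  have hreg1 : retr (regroup ρ) = 1 := by rw [retr_regroup, hρ1]
  have hAC : 0 ≤ marginalAC ρ := by rw [marginalAC]; exact marginalRight_nonneg hreg
  have hAC1 : retr (marginalAC ρ) = 1 := by rw [marginalAC, retr_marginalRight, hreg1]
  have hq2 : 0 < q ^ 2 := by positivity
  obtain ⟨τ, hτ, a, -, hτle⟩ :=
    exists_of_smoothImax_lt (lt_top_iff_ne_top.2 (smoothImax_ne_top hq2 hAC hAC1))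
  obtain ⟨ω, hω, b, -, hωle⟩ :=
    exists_of_smoothImax_lt (lt_top_iff_ne_top.2 (smoothImax_ne_top hq2 hreg hreg1))
  by_contra! hle
  set k := 9 * ((2 : ℝ) ^ a * (2 : ℝ) ^ b) / q ^ 6 with hk
  have hk0 : 0 < k := by positivity
  -- This `m` makes the final coefficient exactly `1 / 2`.
  have hm : 0 < 1 / (2 * k) := by positivity
  obtain ⟨ω', hω', hle'⟩ := exists_mem_ball_le hρ hρ1 hq hq1.le hτ hω hτle hωle hm
    (by linarith)
  obtain ⟨h0, h1, h2⟩ := (mem_ball_iff hρ).1 hω'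
  have h3 := h1.symm.retr_le
  have h4 := one_le_mul_retr_of_le h0 hle' (by linarith)
  have e : 9 * ((2 : ℝ) ^ a * (2 : ℝ) ^ b * (1 / (2 * k))) / q ^ 6 = 1 / 2 := by
    have : 9 * ((2 : ℝ) ^ a * (2 : ℝ) ^ b * (1 / (2 * k))) / q ^ 6 = k * (1 / (2 * k)) := by
      rw [hk]; ring
    rw [this]; field_simp
  rw [e] at h4
  linarith

lemma smoothImax_chain_rule {ρ : Matrix ((A × B) × C) ((A × B) × C) ℂ} (hρ : 0 ≤ ρ)
    (hρ1 : retr ρ = 1) {q : ℝ} (hq : 0 < q) (hq1 : q < 1 / 1000) :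
    smoothImax (1000 * q) ρ ≤ smoothImax (q ^ 2) (marginalAC ρ) + smoothImax (q ^ 2) (regroup ρ) -
      IH (q ^ 2) (marginalAB ρ) + (Real.logb 2 (9 / q ^ 6) : ℝ) := by
  have hreg : 0 ≤ regroup ρ :=
    nonneg_iff_posSemidef.2 ((nonneg_iff_posSemidef.1 hρ).submatrix _)
  have hreg1 : retr (regroup ρ) = 1 := by rw [retr_regroup, hρ1]
  have hAC : 0 ≤ marginalAC ρ := by rw [marginalAC]; exact marginalRight_nonneg hreg
  have hAC1 : retr (marginalAC ρ) = 1 := by rw [marginalAC, retr_marginalRight, hreg1]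
  have hq2 : q ^ 2 < 1 := by nlinarith
  have hm := minError_marginalAB_pos hρ hρ1 hq hq1
  rw [IH, DH, if_neg hm.ne']
  set m := minError (q ^ 2) (marginalAB ρ)
    (marginalLeft (marginalAB ρ) ⊗ₖ marginalRight (marginalAB ρ)) with hmdef
  set k := Real.logb 2 (9 / q ^ 6) with hk
  -- The finite terms are moved to the left so that only the sum of two infima remains on the right;
  -- it can then be approached through strict upper bounds `a'` and `b'`, as neither infimum is `⊥`.
  have key : smoothImax (1000 * q) ρ + ((-Real.logb 2 m - k : ℝ) : EReal) ≤
      smoothImax (q ^ 2) (marginalAC ρ) + smoothImax (q ^ 2) (regroup ρ) := by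
    refine EReal.le_add_of_forall_gt (Or.inl (smoothImax_ne_bot hq2 hAC hAC1))
      (Or.inr (smoothImax_ne_bot hq2 hreg hreg1)) fun a' ha' b' hb' => ?_
    obtain ⟨τ, hτ, a, ha, hτle⟩ := exists_of_smoothImax_lt ha'
    obtain ⟨ω, hω, b, hb, hωle⟩ := exists_of_smoothImax_lt hb'
    -- The slack `minError < 2 * m` makes it unnecessary that an optimal test exists: `m` can be the
    -- minimal error itself, since it is positive.
    obtain ⟨ω', hω', hle'⟩ := exists_mem_ball_le hρ hρ1 hq hq1.le hτ hω hτle hωle hm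
      (by linarith)
    have h1 := smoothImax_le hω' (by positivity) hle'
    have e : Real.logb 2 (9 * ((2 : ℝ) ^ a * (2 : ℝ) ^ b * m) / q ^ 6) =
        a + b + Real.logb 2 m + k := by
      rw [show 9 * ((2 : ℝ) ^ a * (2 : ℝ) ^ b * m) / q ^ 6 =
          (2 : ℝ) ^ a * (2 : ℝ) ^ b * m * (9 / q ^ 6) by ring,
        Real.logb_mul (by positivity) (by positivity), Real.logb_mul (by positivity) hm.ne',
        Real.logb_mul (by positivity) (by positivity), Real.logb_rpow (by norm_num) (by norm_num),
        Real.logb_rpow (by norm_num) (by norm_num)]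
    rw [e] at h1
    calc smoothImax (1000 * q) ρ + ((-Real.logb 2 m - k : ℝ) : EReal)
        ≤ ((a + b + Real.logb 2 m + k : ℝ) : EReal) + ((-Real.logb 2 m - k : ℝ) : EReal) := by
          gcongr
      _ = (a : EReal) + (b : EReal) := by
          rw [← EReal.coe_add, ← EReal.coe_add]; congr 1; ring
      _ ≤ a' + b' := add_le_add ha.le hb.le
  calc smoothImax (1000 * q) ρ
      = smoothImax (1000 * q) ρ + ((-Real.logb 2 m - k : ℝ) : EReal) +
          ((Real.logb 2 m + k : ℝ) : EReal) := by
        rw [add_assoc, ← EReal.coe_add, show -Real.logb 2 m - k + (Real.logb 2 m + k) = 0 by ring,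
          EReal.coe_zero, add_zero]
    _ ≤ _ := add_le_add key le_rfl
    _ = _ := by
        rw [sub_eq_add_neg, ← EReal.coe_neg, neg_neg, EReal.coe_add, add_assoc, add_assoc,
          add_assoc]

lemma logb_bound {ε : ℝ} (hε : 0 < ε) :
    Real.logb 2 (9 / (ε / 1000) ^ 6) ≤ 64 * (1 + |Real.logb 2 ε|) := by
  have e : (9 : ℝ) / (ε / 1000) ^ 6 = 9 * 1000 ^ 6 / ε ^ 6 := by field_simp
  -- Indeed `9 * 10 ^ 18 < 2 ^ 64`; the remaining term is `-6 * log ε`.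
  have h1 : Real.logb 2 (9 * 1000 ^ 6) ≤ 64 := by
    rw [Real.logb_le_iff_le_rpow (by norm_num) (by norm_num)]
    norm_num
  rw [e, Real.logb_div (by norm_num) (by positivity), Real.logb_pow]
  have h2 := neg_abs_le (Real.logb 2 ε)
  have h3 := abs_nonneg (Real.logb 2 ε)
  push_cast
  linarith

end Main
end OneShot
end

theorem mainTheorem2 :
    ∃ c K : ℝ, 0 < c ∧ c ≤ 1 ∧ 0 < K ∧
      ∀ (A : Type*) (B : Type*) (C : Type*) [Fintype A] [Fintype B] [Fintype C]
        [DecidableEq A] [DecidableEq B] [DecidableEq C]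
        (ρ : Matrix ((A × B) × C) ((A × B) × C) ℂ), OneShot.IsState ρ →
      ∀ ε : ℝ, 0 < ε →
        OneShot.smoothImax ε ρ ≤
          OneShot.smoothImax (c * ε ^ 2) (OneShot.marginalAC ρ)
            + OneShot.smoothImax (c * ε ^ 2) (OneShot.regroup ρ)
            - OneShot.IH (c * ε ^ 2) (OneShot.marginalAB ρ)
            + ((K * (1 + |Real.logb 2 ε|) : ℝ) : EReal) := by
  -- The radius `1000 * q` must equal `ε`, so `q ^ 2 = ε ^ 2 / 1000 ^ 2`.
  refine ⟨1 / 1000 ^ 2, 64, by norm_num, by norm_num, by norm_num, ?_⟩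
  intro A B C _ _ _ _ _ _ ρ hρ ε hε
  rcases le_or_gt 1 ε with h1 | h1
  · rw [OneShot.smoothImax_eq_bot h1 hρ.nonneg hρ.retr_eq_one]
    exact bot_le
  · have h := OneShot.smoothImax_chain_rule hρ.nonneg hρ.retr_eq_one (q := ε / 1000)
      (by positivity) (by linarith)
    rw [show 1000 * (ε / 1000) = ε by ring, show (ε / 1000) ^ 2 = 1 / 1000 ^ 2 * ε ^ 2 by ring] at h
    exact h.trans (add_le_add le_rfl (EReal.coe_le_coe_iff.2 (OneShot.logb_bound hε)))
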